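/- Let $(\mathcal M,\otimes,\mathbf 1,\sigma)$ be a braided monoidal category with equalizers and coequalizers, which are preserved by $X\otimes(-)$ and $(-)\otimes X$ for every object $X$. Let $\mathsf{Hopf}_{\mathrm{coc}}(\mathcal M)$ be the category of cocommutative Hopf monoids in $\mathcal M$ (with zero morphisms $u_B\varepsilon_A:A\to B$), let $A=(A,m_A,u_A,\Delta_A,\varepsilon_A,S_A)$ be an object of it, and let $\mathsf{Comon}_{\mathrm{coc}}({}_A\mathcal M)$ be the category of left $A$-modules $Q$ with a cocommutative comonoid structure in $\mathcal M$ whose comultiplication and counit are $A$-linear, with the $A$-linear comonoid morphisms; $A$ is an object of it with action $m_A$. A subobject of $A$ in $\mathsf{Hopf}_{\mathrm{coc}}(\mathcal M)$ is an isomorphism class of monomorphisms $i:K\to A$ in that category, and a quotient of $A$ in $\mathsf{Comon}_{\mathrm{coc}}({}_A\mathcal M)$ is an isomorphism class of epimorphisms $\pi:A\to Q$ in that category. Let $\mathcal E$ be the class of subobjects $i:K\to A$ such that $i$ is the equalizer in $\mathcal M$ of $q(u_A\otimes \mathrm{Id}_A)$ and $q(\mathrm{Id}_A\otimes u_A)$,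 where $q:A\otimes A\to A\otimes_K A$ is the coequalizer in $\mathcal M$ of $m_A(\mathrm{Id}_A\otimes i)\otimes \mathrm{Id}_A$ and $\mathrm{Id}_A\otimes m_A(i\otimes \mathrm{Id}_A)$. Let $\mathcal Q$ be the class of quotients $\pi:A\to Q$ such that $\pi$ is the coequalizer in $\mathcal M$ of $(\varepsilon_A\otimes \mathrm{Id}_A)e$ and $(\mathrm{Id}_A\otimes\varepsilon_A)e$, where $e:A\square_Q A\to A\otimes A$ is the equalizer in $\mathcal M$ of $(\mathrm{Id}_A\otimes\pi)\Delta_A\otimes \mathrm{Id}_A$ and $\mathrm{Id}_A\otimes(\pi\otimes \mathrm{Id}_A)\Delta_A$. The Newman bijection is the bijection $\phi_A:\mathcal E\to\mathcal Q$ with inverse $\psi_A$, where $\phi_A(i)$ is the coequalizer in $\mathcal M$ of $m_A(\mathrm{Id}_A\otimes i)$ and $\mathrm{Id}_A\otimes\varepsilon_K$, and $\psi_A(\pi)$ is the equalizer in $\mathcal M$ of $(\pi\otimes \mathrm{Id}_A)\Delta_A$ and $\pi u_A\otimes \mathrm{Id}_A$. Then the Newman bijection exists, every subobject of $A$ that is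 a kernel in $\mathsf{Hopf}_{\mathrm{coc}}(\mathcal M)$ lies in $\mathcal E$, every quotient of $A$ in $\mathsf{Comon}_{\mathrm{coc}}({}_A\mathcal M)$ that is a regular epimorphism in $\mathsf{Hopf}_{\mathrm{coc}}(\mathcal M)$ (that is, its comonoid $Q$ underlies a cocommutative Hopf monoid such that $\pi$ is a morphism, and a regular epimorphism, of $\mathsf{Hopf}_{\mathrm{coc}}(\mathcal M)$) lies in $\mathcal Q$, and a subobject $i\in\mathcal E$ is a kernel in $\mathsf{Hopf}_{\mathrm{coc}}(\mathcal M)$ if and only if $\phi_A(i)$ is a regular epimorphism in $\mathsf{Hopf}_{\mathrm{coc}}(\mathcal M)$. Hence the Newman bijection restricts to a bijection between the subobjects of $A$ that are kernels in $\mathsf{Hopf}_{\mathrm{coc}}(\mathcal M)$ and the quotients of $A$ in $\mathsf{Comon}_{\mathrm{coc}}({}_A\mathcal M)$ that are regular epimorphisms in $\mathsf{Hopf}_{\mathrm{coc}}(\mathcal M)$. -/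

import Mathlib

open CategoryTheory MonoidalCategory Limits Opposite
open scoped MonObj ComonObj

universe v u

noncomputable section

namespace NewmanHopf

variable {C : Type u} [Category.{v} C] [MonoidalCategory C]

/-! ### Balanced tensor products and cotensor products -/

section Balanced

variable [HasCoequalizers C] {M R X : C}

/-- `M ⊗_R X` for a right action `ν : M ⊗ R ⟶ M` and a left action `m : R ⊗ X ⟶ X`: the
coequalizer in `C` of `ν ⊗ 1` and `1 ⊗ m`. -/
def balancedTensor (ν : M ⊗ R ⟶ M) (m : R ⊗ X ⟶ X) : C :=
  coequalizer (ν ▷ X) ((α_ M R X).hom ≫ M ◁ m)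

/-- The canonical projection `q : M ⊗ X ⟶ M ⊗_R X`. -/
def balancedTensorProj (ν : M ⊗ R ⟶ M) (m : R ⊗ X ⟶ X) : M ⊗ X ⟶ balancedTensor ν m :=
  coequalizer.π (ν ▷ X) ((α_ M R X).hom ≫ M ◁ m)

end Balanced

section Cotensor

variable [HasEqualizers C] {V D W : C}

/-- `V □_D W` for a right coaction `ρ : V ⟶ V ⊗ D` and a left coaction `l : W ⟶ D ⊗ W`: the
equalizer in `C` of `ρ ⊗ 1` and `1 ⊗ l`. -/
def cotensor (ρ : V ⟶ V ⊗ D) (l : W ⟶ D ⊗ W) : C :=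
  equalizer (ρ ▷ W ≫ (α_ V D W).hom) (V ◁ l)

/-- The canonical inclusion `e : V □_D W ⟶ V ⊗ W`. -/
def cotensorIncl (ρ : V ⟶ V ⊗ D) (l : W ⟶ D ⊗ W) : cotensor ρ l ⟶ V ⊗ W :=
  equalizer.ι (ρ ▷ W ≫ (α_ V D W).hom) (V ◁ l)

end Cotensor

variable [BraidedCategory C]

/-! ### The category of cocommutative Hopf monoids -/

variable (C) in
/-- A cocommutative Hopf monoid in the braided monoidal category `C`. -/
structure CocHopf where
  /-- The underlying object. -/
  X : C
  [hopf : HopfObj X]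
  [comm : IsCommComonObj X]

attribute [instance] CocHopf.hopf CocHopf.comm

namespace CocHopf

/-- A morphism of cocommutative Hopf monoids is a morphism of the underlying bimonoids
(it automatically commutes with the antipodes, see `HopfObj.hom_antipode`). -/
@[ext]
structure Hom (A B : CocHopf C) where
  /-- The underlying morphism. -/
  hom : A.X ⟶ B.X
  [isBimonHom : IsBimonHom hom]

attribute [instance] Hom.isBimonHom

instance : Category (CocHopf C) where
  Hom A B := Hom A B
  id A := { hom := 𝟙 A.X, isBimonHom := { } }
  comp f g := { hom := f.hom ≫ g.hom, isBimonHom := { } }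

@[ext]
theorem hom_ext {A B : CocHopf C} {f g : A ⟶ B} (h : f.hom = g.hom) : f = g := Hom.ext h

@[simp]
theorem id_hom (A : CocHopf C) : Hom.hom (𝟙 A) = 𝟙 A.X := rfl

@[simp]
theorem comp_hom {A B D : CocHopf C} (f : A ⟶ B) (g : B ⟶ D) :
    (f ≫ g).hom = f.hom ≫ g.hom := rfl

instance {A B : CocHopf C} (f : A ⟶ B) : IsBimonHom f.hom := f.isBimonHom

/-- The trivial morphism `A ⟶ B`, that is the counit of `A` followed by the unit of `B`. -/
def trivialHom (A B : CocHopf C) : A ⟶ B where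
  hom := ε[A.X] ≫ η[B.X]
  isBimonHom :=
    { one_hom := by simp
      mul_hom := by
        have h : (η[B.X] ⊗ₘ η[B.X]) ≫ μ = (λ_ (𝟙_ C)).hom ≫ η[B.X] := by
          rw [tensorHom_def', Category.assoc, MonObj.one_mul, leftUnitor_naturality]
        rw [← tensorHom_comp_tensorHom, Category.assoc, h, Bimon.mul_counit_assoc]
      hom_counit := by simp
      hom_comul := by
        have h : Δ[A.X] ≫ (ε[A.X] ⊗ₘ ε[A.X]) = ε[A.X] ≫ (λ_ (𝟙_ C)).inv := by
          rw [MonoidalCategory.tensorHom_def, ComonObj.counit_comul_assoc, leftUnitor_inv_naturality]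
        rw [← tensorHom_comp_tensorHom, reassoc_of% h, Category.assoc, Bimon.one_comul] }

/-- The category of cocommutative Hopf monoids has zero morphisms: the zero morphism `A ⟶ B` is
the composite of the counit of `A` and the unit of `B`. -/
instance : HasZeroMorphisms (CocHopf C) where
  zero A B := ⟨trivialHom A B⟩
  comp_zero f E := by
    ext
    change Hom.hom f ≫ ε ≫ η = ε ≫ η
    simp
  zero_comp A {B E} f := by
    ext
    change (ε[A.X] ≫ η[B.X]) ≫ Hom.hom f = ε ≫ η
    simp

/-- A morphism of cocommutative Hopf monoids is a kernel if it is the kernel, in the category of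
cocommutative Hopf monoids, of some morphism. -/
def IsKernelHom {K A : CocHopf C} (i : K ⟶ A) : Prop :=
  Nonempty (NormalMono i)

end CocHopf

/-! ### Cocommutative comonoids in the category of left `A`-modules -/

/-- A cocommutative comonoid in the monoidal category of left `A`-modules (with the diagonal
action on tensor products and the trivial action on the unit): a left `A`-module which is a
cocommutative comonoid in `C` and whose comultiplication and counit are `A`-linear. -/
structure CocModComon (A : CocHopf C) where
  /-- The underlying object. -/
  X : C
  [comon : ComonObj X]
  [comm : IsCommComonObj X]
  [mod : ModObj A.X X]
  comul_linear : (γ[A.X, X] : A.X ⊗ X ⟶ X) ≫ Δ[X] =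
    A.X ◁ Δ[X] ≫ Δ[A.X] ▷ (X ⊗ X) ≫ tensorμ A.X A.X X X ≫
      ((γ[A.X, X] : A.X ⊗ X ⟶ X) ⊗ₘ (γ[A.X, X] : A.X ⊗ X ⟶ X))
  counit_linear : (γ[A.X, X] : A.X ⊗ X ⟶ X) ≫ ε[X] =
    A.X ◁ ε[X] ≫ ε[A.X] ▷ (𝟙_ C) ≫ (λ_ (𝟙_ C)).hom

attribute [instance] CocModComon.comon CocModComon.comm CocModComon.mod

namespace CocModComon

variable {A : CocHopf C}

/-- The action `A ⊗ Q ⟶ Q`. -/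
def act (Q : CocModComon A) : A.X ⊗ Q.X ⟶ Q.X := γ[A.X, Q.X]

/-- Morphisms are the `A`-linear comonoid morphisms. -/
@[ext]
structure Hom (P Q : CocModComon A) where
  /-- The underlying morphism. -/
  hom : P.X ⟶ Q.X
  [isComonHom : IsComonHom hom]
  linear : P.act ≫ hom = A.X ◁ hom ≫ Q.act

attribute [instance] Hom.isComonHom

instance : Category (CocModComon A) where
  Hom P Q := Hom P Q
  id P := { hom := 𝟙 P.X, linear := by simp }
  comp f g :=
    { hom := f.hom ≫ g.hom
      linear := by rw [← Category.assoc, f.linear, Category.assoc, g.linear,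
        whiskerLeft_comp, Category.assoc] }

@[ext]
theorem hom_ext {P Q : CocModComon A} {f g : P ⟶ Q} (h : f.hom = g.hom) : f = g := Hom.ext h

@[simp]
theorem id_hom (P : CocModComon A) : Hom.hom (𝟙 P) = 𝟙 P.X := rfl

@[simp]
theorem comp_hom {P Q R : CocModComon A} (f : P ⟶ Q) (g : Q ⟶ R) :
    (f ≫ g).hom = f.hom ≫ g.hom := rfl

variable (A) in
/-- `A` itself, with its multiplication as left action. -/
def regular : CocModComon A where
  X := A.X
  mod := ModObj.regular A.X
  comul_linear := by
    change μ[A.X] ≫ Δ[A.X] = A.X ◁ Δ[A.X] ≫ Δ[A.X] ▷ (A.X ⊗ A.X) ≫ tensorμ A.X A.X A.X A.X ≫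
      (μ[A.X] ⊗ₘ μ[A.X])
    rw [BimonObj.mul_comul, tensorHom_def', Category.assoc]
  counit_linear := by
    change μ[A.X] ≫ ε[A.X] = A.X ◁ ε[A.X] ≫ ε[A.X] ▷ (𝟙_ C) ≫ (λ_ (𝟙_ C)).hom
    rw [Bimon.mul_counit, tensorHom_def', Category.assoc]

/-- The underlying morphism `A ⟶ Q` in `C` of a morphism from the regular object. -/
abbrev proj {Q : CocModComon A} (p : regular A ⟶ Q) : A.X ⟶ Q.X := Hom.hom p

/-- A morphism `p : A ⟶ Q` of cocommutative comonoids in left `A`-modules is a regular epimorphism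
of cocommutative Hopf monoids: the comonoid `Q` underlies a cocommutative Hopf monoid for which
`p` is a morphism of cocommutative Hopf monoids, and a regular epimorphism in that category.
(The Hopf monoid is given as an object `H` together with an isomorphism of comonoids `H ≅ Q`.) -/
def IsRegularEpiOfHopf {Q : CocModComon A} (p : regular A ⟶ Q) : Prop :=
  ∃ (H : CocHopf C) (f : A ⟶ H) (e : H.X ≅ Q.X),
    IsComonHom e.hom ∧ f.hom ≫ e.hom = proj p ∧ IsRegularEpi f

end CocModComon

/-! ### Subobjects, quotients and the maps of the Newman correspondence -/

/-- The subobjects of `A` in the category of cocommutative Hopf monoids: isomorphism classes of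
monomorphisms with codomain `A`. -/
abbrev HopfSubobject (A : CocHopf C) := Subobject A

/-- The quotients of `A` in the category of cocommutative comonoids in left `A`-modules:
isomorphism classes of epimorphisms with domain `A`. -/
abbrev ModComonQuotient (A : CocHopf C) := Subobject (op (CocModComon.regular A))

/-- A chosen epimorphism `A ⟶ Q` representing a quotient of `A`. -/
abbrev ModComonQuotient.π {A : CocHopf C} (Q : ModComonQuotient A) :
    CocModComon.regular A ⟶ (Subobject.underlying.obj Q).unop :=
  (Subobject.arrow Q).unop

section Newman

variable {A K : CocHopf C} {Q : CocModComon A}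

/-- `p = φ_A(i)`: the morphism `p : A ⟶ Q` is the coequalizer in `C` of
`m_A (1 ⊗ i)` and `1 ⊗ ε_K`. -/
def IsPhi (i : K ⟶ A) (p : CocModComon.regular A ⟶ Q) : Prop :=
  ∃ w : (A.X ◁ i.hom ≫ μ[A.X]) ≫ CocModComon.proj p =
      (A.X ◁ ε[K.X] ≫ (ρ_ A.X).hom) ≫ CocModComon.proj p,
    Nonempty (IsColimit (Cofork.ofπ (CocModComon.proj p) w))

/-- `i = ψ_A(p)`: the morphism `i : K ⟶ A` is the equalizer in `C` of
`(p ⊗ 1) Δ_A` and `p u_A ⊗ 1`. -/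
def IsPsi (p : CocModComon.regular A ⟶ Q) (i : K ⟶ A) : Prop :=
  ∃ w : i.hom ≫ (Δ[A.X] ≫ CocModComon.proj p ▷ A.X) =
      i.hom ≫ ((λ_ A.X).inv ≫ (η[A.X] ≫ CocModComon.proj p) ▷ A.X),
    Nonempty (IsLimit (Fork.ofι i.hom w))

/-- The projection `q : A ⊗ A ⟶ A ⊗_K A`, where `K` acts on both sides of `A` through `i`. -/
def balancedProj [HasCoequalizers C] (i : K ⟶ A) :
    A.X ⊗ A.X ⟶ balancedTensor (A.X ◁ i.hom ≫ μ[A.X]) (i.hom ▷ A.X ≫ μ[A.X]) :=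
  balancedTensorProj (A.X ◁ i.hom ≫ μ[A.X]) (i.hom ▷ A.X ≫ μ[A.X])

/-- `i : K ⟶ A` is the equalizer in `C` of `q (u_A ⊗ 1)` and `q (1 ⊗ u_A)`, where
`q : A ⊗ A ⟶ A ⊗_K A` is the projection. -/
def IsBalancedEqualizer [HasCoequalizers C] (i : K ⟶ A) : Prop :=
  ∃ w : i.hom ≫ ((λ_ A.X).inv ≫ η[A.X] ▷ A.X ≫ balancedProj i) =
      i.hom ≫ ((ρ_ A.X).inv ≫ A.X ◁ η[A.X] ≫ balancedProj i),
    Nonempty (IsLimit (Fork.ofι i.hom w))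

/-- The inclusion `e : A □_Q A ⟶ A ⊗ A`, where `Q` coacts on both sides of `A` through `p`. -/
def cotensorInclOf [HasEqualizers C] (p : CocModComon.regular A ⟶ Q) :
    cotensor (Δ[A.X] ≫ A.X ◁ CocModComon.proj p) (Δ[A.X] ≫ CocModComon.proj p ▷ A.X) ⟶
      A.X ⊗ A.X :=
  cotensorIncl (Δ[A.X] ≫ A.X ◁ CocModComon.proj p) (Δ[A.X] ≫ CocModComon.proj p ▷ A.X)

/-- `p : A ⟶ Q` is the coequalizer in `C` of `(ε_A ⊗ 1) e` and `(1 ⊗ ε_A) e`, where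
`e : A □_Q A ⟶ A ⊗ A` is the inclusion. -/
def IsCotensorCoequalizer [HasEqualizers C] (p : CocModComon.regular A ⟶ Q) : Prop :=
  ∃ w : (cotensorInclOf p ≫ ε[A.X] ▷ A.X ≫ (λ_ A.X).hom) ≫ CocModComon.proj p =
      (cotensorInclOf p ≫ A.X ◁ ε[A.X] ≫ (ρ_ A.X).hom) ≫ CocModComon.proj p,
    Nonempty (IsColimit (Cofork.ofπ (CocModComon.proj p) w))

end Newman

end NewmanHopf

end

/-! Everything rests on the shear `a ⊗ b ↦ a₁ ⊗ a₂ b` of `A ⊗ A`, which is invertible because `A`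
has an antipode. For `p = φ(i)`, the shear followed by `p ⊗ 1` is a coequalizer of the pair that
defines `A ⊗_K A`. Through it `q (u ⊗ 1)` and `q (1 ⊗ u)` become `a ↦ p(1) ⊗ a` and `a ↦ p(a₁) ⊗
a₂`, the two maps that define `ψ(p)`. Hence `i` lies in `𝓔` exactly when `i = ψ(φ(i))`
(`isBalancedEqualizer_iff`). Dually, if `i = ψ(p)`, the shear carries `A ⊗ K` onto `A □_Q A` and the
two counits become `m (1 ⊗ i)` and `1 ⊗ ε`. Hence `p` lies in `𝓠` exactly when `p = φ(ψ(p))`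
(`isCotensorCoequalizer_iff`). Once `φ` and `ψ` are known to take values in the right categories
(`exists_isPhi`, `exists_isPsi`), the Newman bijection is formal.

The kernel of a Hopf morphism `f` is `ψ(f)`, and `ψφψ = ψ`, so kernels lie in `𝓔`. For such a kernel
`K`, the relation `k a ~ ε(k) a` already holds in `φ(i)` (`mul_proj_of_isPsi_homOfHom`), so `φ(i)`
is a Hopf quotient and a cokernel of `i`. A regular epimorphism `f` is `φ` of its kernel
(`isCoequalizerOf_of_isRegularEpi`): if `f` coequalizes `l` and `r`, the convolution quotient `r⁻¹
l` lands in the kernel, as for groups. So regular epimorphisms lie in `𝓠`. Conversely, if `i` is in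
`𝓔` and `φ(i)` is a Hopf morphism, then `i = ψ(φ(i))` is its kernel. -/

open scoped HopfObj

noncomputable section

namespace NewmanHopf

/-! ### Equalizers and coequalizers as properties -/

section Universal

variable {C : Type u} [Category.{v} C]

/-- `i` is an equalizer of `f` and `g`. -/
structure IsEqualizerOf {X Y Z : C} (f g : Y ⟶ Z) (i : X ⟶ Y) : Prop where
  mono : Mono i
  w : i ≫ f = i ≫ g
  lift : ∀ {T : C} (t : T ⟶ Y), t ≫ f = t ≫ g → ∃ s : T ⟶ X, s ≫ i = t

/-- `p` is a coequalizer of `f` and `g`. -/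
structure IsCoequalizerOf {X Y Z : C} (f g : X ⟶ Y) (p : Y ⟶ Z) : Prop where
  epi : Epi p
  w : f ≫ p = g ≫ p
  desc : ∀ {T : C} (t : Y ⟶ T), f ≫ t = g ≫ t → ∃ s : Z ⟶ T, p ≫ s = t

theorem isEqualizerOf_iff {X Y Z : C} {f g : Y ⟶ Z} {i : X ⟶ Y} :
    IsEqualizerOf f g i ↔ ∃ w : i ≫ f = i ≫ g, Nonempty (IsLimit (Fork.ofι i w)) := by
  constructor
  · intro h
    have := h.mono
    exact ⟨h.w, ⟨Fork.IsLimit.mk _ (fun s => (h.lift s.ι s.condition).choose)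
      (fun s => (h.lift s.ι s.condition).choose_spec)
      (fun s m hm => by
        rw [← cancel_mono i]
        exact hm.trans (h.lift s.ι s.condition).choose_spec.symm)⟩⟩
  · rintro ⟨w, ⟨h⟩⟩
    refine ⟨⟨fun a b hab => Fork.IsLimit.hom_ext h hab⟩, w, fun t ht => ?_⟩
    exact ⟨Fork.IsLimit.lift h t ht, Fork.IsLimit.lift_ι h⟩

theorem isCoequalizerOf_iff {X Y Z : C} {f g : X ⟶ Y} {p : Y ⟶ Z} :
    IsCoequalizerOf f g p ↔ ∃ w : f ≫ p = g ≫ p, Nonempty (IsColimit (Cofork.ofπ p w)) := by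
  constructor
  · intro h
    have := h.epi
    exact ⟨h.w, ⟨Cofork.IsColimit.mk _ (fun s => (h.desc s.π s.condition).choose)
      (fun s => (h.desc s.π s.condition).choose_spec)
      (fun s m hm => by
        rw [← cancel_epi p]
        exact hm.trans (h.desc s.π s.condition).choose_spec.symm)⟩⟩
  · rintro ⟨w, ⟨h⟩⟩
    refine ⟨⟨fun a b hab => Cofork.IsColimit.hom_ext h hab⟩, w, fun t ht => ?_⟩
    exact ⟨Cofork.IsColimit.desc h t ht, Cofork.IsColimit.π_desc h⟩

theorem isEqualizerOf_ι {Y Z : C} (f g : Y ⟶ Z) [HasEqualizer f g] :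
    IsEqualizerOf f g (equalizer.ι f g) :=
  isEqualizerOf_iff.2 ⟨equalizer.condition f g, ⟨equalizerIsEqualizer f g⟩⟩

theorem isCoequalizerOf_π {Y Z : C} (f g : Y ⟶ Z) [HasCoequalizer f g] :
    IsCoequalizerOf f g (coequalizer.π f g) :=
  isCoequalizerOf_iff.2 ⟨coequalizer.condition f g, ⟨coequalizerIsCoequalizer f g⟩⟩

theorem IsEqualizerOf.map {D : Type*} [Category D] {X Y Z : C} {f g : Y ⟶ Z} {i : X ⟶ Y}
    (h : IsEqualizerOf f g i) (F : C ⥤ D) [PreservesLimitsOfShape WalkingParallelPair F] :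
    IsEqualizerOf (F.map f) (F.map g) (F.map i) := by
  obtain ⟨w, ⟨l⟩⟩ := isEqualizerOf_iff.1 h
  exact isEqualizerOf_iff.2 ⟨_, ⟨isLimitForkMapOfIsLimit F w l⟩⟩

theorem IsCoequalizerOf.map {D : Type*} [Category D] {X Y Z : C} {f g : X ⟶ Y} {p : Y ⟶ Z}
    (h : IsCoequalizerOf f g p) (F : C ⥤ D) [PreservesColimitsOfShape WalkingParallelPair F] :
    IsCoequalizerOf (F.map f) (F.map g) (F.map p) := by
  obtain ⟨w, ⟨l⟩⟩ := isCoequalizerOf_iff.1 h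
  exact isCoequalizerOf_iff.2 ⟨_, ⟨isColimitCoforkMapOfIsColimit F w l⟩⟩

/-- Equalizers only depend on the relation that the two morphisms define. -/
theorem IsEqualizerOf.congr {X Y Z Z' : C} {f g : Y ⟶ Z} {f' g' : Y ⟶ Z'} {i : X ⟶ Y}
    (h : IsEqualizerOf f g i)
    (hfg : ∀ {T : C} (t : T ⟶ Y), t ≫ f = t ≫ g ↔ t ≫ f' = t ≫ g') :
    IsEqualizerOf f' g' i :=
  ⟨h.mono, (hfg i).1 h.w, fun t ht => h.lift t ((hfg t).2 ht)⟩

/-- Coequalizers only depend on the relation that the two morphisms define. -/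
theorem IsCoequalizerOf.congr {X X' Y Z : C} {f g : X ⟶ Y} {f' g' : X' ⟶ Y} {p : Y ⟶ Z}
    (h : IsCoequalizerOf f g p)
    (hfg : ∀ {T : C} (t : Y ⟶ T), f ≫ t = g ≫ t ↔ f' ≫ t = g' ≫ t) :
    IsCoequalizerOf f' g' p :=
  ⟨h.epi, (hfg p).1 h.w, fun t ht => h.desc t ((hfg t).2 ht)⟩

theorem IsEqualizerOf.iso_comp {X X' Y Z : C} {f g : Y ⟶ Z} {i : X ⟶ Y}
    (h : IsEqualizerOf f g i) (e : X' ≅ X) : IsEqualizerOf f g (e.hom ≫ i) := by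
  have := h.mono
  refine ⟨inferInstance, by simp [h.w], fun t ht => ?_⟩
  obtain ⟨s, hs⟩ := h.lift t ht
  exact ⟨s ≫ e.inv, by simp [hs]⟩

theorem IsCoequalizerOf.comp_iso {X Y Z Z' : C} {f g : X ⟶ Y} {p : Y ⟶ Z}
    (h : IsCoequalizerOf f g p) (e : Z ≅ Z') : IsCoequalizerOf f g (p ≫ e.hom) := by
  have := h.epi
  refine ⟨inferInstance, by simp [reassoc_of% h.w], fun t ht => ?_⟩
  obtain ⟨s, hs⟩ := h.desc t ht
  exact ⟨e.inv ≫ s, by simp [hs]⟩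

/-- Two equalizers of the same pair are isomorphic. -/
theorem IsEqualizerOf.exists_iso {X X' Y Z : C} {f g : Y ⟶ Z} {i : X ⟶ Y} {i' : X' ⟶ Y}
    (h : IsEqualizerOf f g i) (h' : IsEqualizerOf f g i') : ∃ e : X ≅ X', e.hom ≫ i' = i := by
  have := h.mono
  have := h'.mono
  obtain ⟨s, hs⟩ := h.lift i' h'.w
  obtain ⟨t, ht⟩ := h'.lift i h.w
  exact ⟨⟨t, s, by simp [← cancel_mono i, hs, ht], by simp [← cancel_mono i', hs, ht]⟩, ht⟩

/-- Two coequalizers of the same pair are isomorphic. -/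
theorem IsCoequalizerOf.exists_iso {X Y Z Z' : C} {f g : X ⟶ Y} {p : Y ⟶ Z} {p' : Y ⟶ Z'}
    (h : IsCoequalizerOf f g p) (h' : IsCoequalizerOf f g p') :
    ∃ e : Z ≅ Z', p ≫ e.hom = p' := by
  have := h.epi
  have := h'.epi
  obtain ⟨s, hs⟩ := h.desc p' h'.w
  obtain ⟨t, ht⟩ := h'.desc p h.w
  exact ⟨⟨s, t, by simp [← cancel_epi p, reassoc_of% hs, ht],
    by simp [← cancel_epi p', reassoc_of% ht, hs]⟩, hs⟩

end Universal

/-! ### Morphisms out of comonoids -/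

section Comonoid

variable {C : Type u} [Category.{v} C] [MonoidalCategory C]

/-- The pairing `d ↦ f d₁ ⊗ g d₂` of two morphisms out of a comonoid. -/
def pair {D X Y : C} [ComonObj D] (f : D ⟶ X) (g : D ⟶ Y) : D ⟶ X ⊗ Y :=
  Δ[D] ≫ (f ⊗ₘ g)

section

variable {D E X Y Z W : C} [ComonObj D] [ComonObj E]

@[simp]
theorem pair_tensorHom (f : D ⟶ X) (g : D ⟶ Y) (a : X ⟶ Z) (b : Y ⟶ W) :
    pair f g ≫ (a ⊗ₘ b) = pair (f ≫ a) (g ≫ b) := by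
  simp [pair]

@[simp]
theorem pair_whiskerRight (f : D ⟶ X) (g : D ⟶ Y) (a : X ⟶ Z) :
    pair f g ≫ a ▷ Y = pair (f ≫ a) g := by
  rw [← tensorHom_id, pair_tensorHom, Category.comp_id]

@[simp]
theorem pair_whiskerLeft (f : D ⟶ X) (g : D ⟶ Y) (b : Y ⟶ W) :
    pair f g ≫ X ◁ b = pair f (g ≫ b) := by
  rw [← id_tensorHom, pair_tensorHom, Category.comp_id]

theorem comp_pair (h : E ⟶ D) [IsComonHom h] (f : D ⟶ X) (g : D ⟶ Y) :
    h ≫ pair f g = pair (h ≫ f) (h ≫ g) := by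
  simp [pair]

theorem pair_id_id : pair (𝟙 D) (𝟙 D) = Δ[D] := by simp [pair]

theorem pair_assoc (f : D ⟶ X) (g : D ⟶ Y) (h : D ⟶ Z) :
    pair (pair f g) h ≫ (α_ X Y Z).hom = pair f (pair g h) := by
  have h1 : pair (pair f g) h = Δ[D] ≫ Δ[D] ▷ D ≫ ((f ⊗ₘ g) ⊗ₘ h) := by
    simp only [pair, ← tensorHom_id, tensorHom_comp_tensorHom, Category.id_comp]
  have h2 : pair f (pair g h) = Δ[D] ≫ D ◁ Δ[D] ≫ (f ⊗ₘ (g ⊗ₘ h)) := by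
    simp only [pair, ← id_tensorHom, tensorHom_comp_tensorHom, Category.id_comp]
  rw [h1, h2, Category.assoc, Category.assoc, associator_naturality, ComonObj.comul_assoc_assoc]

theorem pair_counit_left (g : D ⟶ X) (a : 𝟙_ C ⟶ Y) :
    pair (ε[D] ≫ a) g = g ≫ (λ_ X).inv ≫ a ▷ X := by
  rw [← pair_whiskerRight, pair, ComonObj.counit_comul_hom, Category.assoc]

theorem pair_counit_left_hom (g : D ⟶ X) : pair ε[D] g = g ≫ (λ_ X).inv := by
  rw [pair, ComonObj.counit_comul_hom]

theorem pair_counit_right_hom (g : D ⟶ X) : pair g ε[D] = g ≫ (ρ_ X).inv := by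
  rw [pair, ComonObj.comul_counit_hom]

end

/-- The convolution product of two morphisms from a comonoid to a monoid. -/
def conv {D A : C} [ComonObj D] [MonObj A] (f g : D ⟶ A) : D ⟶ A :=
  pair f g ≫ μ[A]

section

variable {D E A B : C} [ComonObj D] [ComonObj E] [MonObj A] [MonObj B]

theorem conv_assoc (f g h : D ⟶ A) : conv (conv f g) h = conv f (conv g h) := by
  rw [conv, conv, ← pair_whiskerRight, Category.assoc, MonObj.mul_assoc, reassoc_of% @pair_assoc,
    reassoc_of% @pair_whiskerLeft]
  rfl

theorem one_conv (f : D ⟶ A) : conv (ε[D] ≫ η[A]) f = f := by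
  simp [conv, pair_counit_left]

theorem comp_conv (h : E ⟶ D) [IsComonHom h] (f g : D ⟶ A) :
    h ≫ conv f g = conv (h ≫ f) (h ≫ g) := by
  rw [conv, reassoc_of% @comp_pair, conv]

theorem conv_comp (f g : D ⟶ A) (h : A ⟶ B) [IsMonHom h] :
    conv f g ≫ h = conv (f ≫ h) (g ≫ h) := by
  rw [conv, Category.assoc, IsMonHom.mul_hom, reassoc_of% @pair_tensorHom, conv]

end

attribute [local instance] ComonObj.instTensorUnit in
theorem isComonHom_counit {A : C} [ComonObj A] : IsComonHom ε[A] where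
  hom_counit := by simp
  hom_comul := by
    rw [ComonObj.instTensorUnit_comul, MonoidalCategory.tensorHom_def, ComonObj.counit_comul_assoc,
      leftUnitor_inv_naturality]

end Comonoid

/-! ### Comonoid morphisms in the braided setting, cocommutativity and convolution inverses. -/

section Braided

variable {C : Type u} [Category.{v} C] [MonoidalCategory C] [BraidedCategory C]

instance isComonHom_tensorHom {A B D E : C} [ComonObj A] [ComonObj B] [ComonObj D] [ComonObj E]
    (f : A ⟶ B) (g : D ⟶ E) [IsComonHom f] [IsComonHom g] : IsComonHom (f ⊗ₘ g) where
  hom_counit := by simp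
  hom_comul := by
    simp only [Comon.tensorObj_comul, tensorHom_comp_tensorHom_assoc, IsComonHom.hom_comul,
      Category.assoc]
    rw [← tensorHom_comp_tensorHom_assoc, tensorμ_natural]

instance isComonHom_whiskerRight {A B D : C} [ComonObj A] [ComonObj B] [ComonObj D]
    (f : A ⟶ B) [IsComonHom f] : IsComonHom (f ▷ D) := by
  rw [← tensorHom_id]; infer_instance

instance isComonHom_whiskerLeft {A B D : C} [ComonObj A] [ComonObj B] [ComonObj D]
    (f : A ⟶ B) [IsComonHom f] : IsComonHom (D ◁ f) := by
  rw [← id_tensorHom]; infer_instance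

instance isComonHom_mul {A : C} [BimonObj A] : IsComonHom μ[A] where
  hom_counit := by simp
  hom_comul := by simp

section

attribute [local instance] ComonObj.instTensorUnit

theorem isComonHom_rightUnitor {A : C} [ComonObj A] : IsComonHom (ρ_ A).hom where
  hom_counit := by simp [tensorHom_def', unitors_equal]
  hom_comul := by
    rw [Comon.tensorObj_comul, ComonObj.instTensorUnit_comul, MonoidalCategory.tensorHom_def,
      Category.assoc, Category.assoc, ← tensor_right_unitality, rightUnitor_naturality]

theorem isComonHom_leftUnitor {A : C} [ComonObj A] : IsComonHom (λ_ A).hom where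
  hom_counit := by simp [MonoidalCategory.tensorHom_def]
  hom_comul := by
    rw [Comon.tensorObj_comul, ComonObj.instTensorUnit_comul, tensorHom_def',
      Category.assoc, Category.assoc, ← tensor_left_unitality, leftUnitor_naturality]

end

/-- The first projection `d ⊗ e ↦ d ε(e)`. -/
def fst (D E : C) [ComonObj E] : D ⊗ E ⟶ D := D ◁ ε[E] ≫ (ρ_ D).hom

/-- The second projection `d ⊗ e ↦ ε(d) e`. -/
def snd (D E : C) [ComonObj D] : D ⊗ E ⟶ E := ε[D] ▷ E ≫ (λ_ E).hom

instance isComonHom_fst {D E : C} [ComonObj D] [ComonObj E] : IsComonHom (fst D E) := by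
  let := ComonObj.instTensorUnit C
  have := isComonHom_counit (A := E)
  have := isComonHom_rightUnitor (A := D)
  unfold fst
  infer_instance

instance isComonHom_snd {D E : C} [ComonObj D] [ComonObj E] : IsComonHom (snd D E) := by
  let := ComonObj.instTensorUnit C
  have := isComonHom_counit (A := D)
  have := isComonHom_leftUnitor (A := E)
  unfold snd
  infer_instance

/-- In `d₁ ε(e₁) ⊗ h(d₂ ⊗ e₂)` the counit removes one copy of `E`, so the braiding inside `tensorμ`
becomes a braiding with the unit object and disappears. -/
theorem pair_fst {D E X : C} [ComonObj D] [ComonObj E] (h : D ⊗ E ⟶ X) :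
    pair (fst D E) h = Δ[D] ▷ E ≫ (α_ D D E).hom ≫ D ◁ h := by
  have key : pair (fst D E) (𝟙 _) = Δ[D] ▷ E ≫ (α_ D D E).hom := by
    have h1 : (fst D E ⊗ₘ 𝟙 (D ⊗ E)) =
        ((𝟙 D ⊗ₘ ε[E]) ⊗ₘ (𝟙 D ⊗ₘ 𝟙 E)) ≫ ((ρ_ D).hom ▷ (D ⊗ E)) := by
      simp only [fst, ← id_tensorHom, ← tensorHom_id, tensorHom_comp_tensorHom, Category.comp_id,
        id_tensorHom_id]
    rw [pair, Comon.tensorObj_comul, Category.assoc, h1, ← tensorμ_natural_assoc,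
      tensorHom_comp_tensorHom_assoc]
    simp only [tensorHom_id, ComonObj.counit_comul, id_whiskerRight, Category.comp_id]
    rw [MonoidalCategory.tensorHom_def, Category.assoc]
    congr 1
    simp only [tensorμ, braiding_tensorUnit_right]
    monoidal
  have := pair_whiskerLeft (fst D E) (𝟙 _) h
  rw [Category.id_comp] at this
  rw [← this, key, Category.assoc]

section Cocommutative

variable {A D : C} [ComonObj D] [IsCommComonObj D]

/-- Rebracketing the fourfold comultiplication displays its two middle factors as a single
comultiplication, which absorbs the braiding of `tensorμ` by cocommutativity. This is what makes
pairings and convolutions of comonoid morphisms comonoid morphisms again. -/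
instance isComonHom_comul : IsComonHom Δ[D] where
  hom_counit := by simp [MonoidalCategory.tensorHom_def]
  hom_comul := by
    have h1 : Δ[D] ≫ (Δ[D] ⊗ₘ Δ[D]) =
        Δ[D] ≫ D ◁ Δ[D] ≫ D ◁ Δ[D] ▷ D ≫ D ◁ (α_ D D D).hom ≫ (α_ D D (D ⊗ D)).inv := by
      rw [show Δ[D] ≫ (Δ[D] ⊗ₘ Δ[D]) = pair (pair (𝟙 D) (𝟙 D)) Δ[D] by rw [pair_id_id, pair],
        ← cancel_mono (α_ D D (D ⊗ D)).hom, pair_assoc, pair]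
      simp [pair]
    rw [Comon.tensorObj_comul, ← Category.assoc, h1]
    simp only [tensorμ, Category.assoc, Iso.inv_hom_id_assoc]
    have h2 : D ◁ (α_ D D D).hom ≫ D ◁ (α_ D D D).inv ≫ D ◁ (β_ D D).hom ▷ D ≫
      D ◁ (α_ D D D).hom ≫ (α_ D D (D ⊗ D)).inv = D ◁ (β_ D D).hom ▷ D ≫
      D ◁ (α_ D D D).hom ≫ (α_ D D (D ⊗ D)).inv := by simp
    rw [h2, ← whiskerLeft_comp_assoc, ← whiskerLeft_comp_assoc, Category.assoc,
      ← comp_whiskerRight, IsCommComonObj.comul_comm,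
      whiskerLeft_comp_assoc]

instance isComonHom_pair {X Y : C} [ComonObj X] [ComonObj Y] (f : D ⟶ X) (g : D ⟶ Y)
    [IsComonHom f] [IsComonHom g] : IsComonHom (pair f g) := by
  unfold pair; infer_instance

end Cocommutative

instance isComonHom_conv {D A : C} [ComonObj D] [IsCommComonObj D] [BimonObj A] (f g : D ⟶ A)
    [IsComonHom f] [IsComonHom g] : IsComonHom (conv f g) := by
  unfold conv; infer_instance

instance isComonHom_antipode {A : C} [HopfObj A] [IsCommComonObj A] : IsComonHom 𝒮[A] where
  hom_counit := by simp
  hom_comul := by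
    rw [HopfObj.antipode_comul, IsCommComonObj.comul_comm_assoc]

theorem conv_antipode {D A : C} [ComonObj D] [HopfObj A] (f : D ⟶ A) [IsComonHom f] :
    conv f (f ≫ 𝒮[A]) = ε[D] ≫ η[A] := by
  have : conv (𝟙 A) 𝒮[A] = ε[A] ≫ η[A] := by
    simp [conv, pair, MonoidalCategory.tensorHom_def, HopfObj.antipode_right]
  rw [← IsComonHom.hom_counit f, Category.assoc, ← this, comp_conv, Category.comp_id]

theorem antipode_conv {D A : C} [ComonObj D] [HopfObj A] (f : D ⟶ A) [IsComonHom f] :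
    conv (f ≫ 𝒮[A]) f = ε[D] ≫ η[A] := by
  have : conv 𝒮[A] (𝟙 A) = ε[A] ≫ η[A] := by
    simp [conv, pair, MonoidalCategory.tensorHom_def, HopfObj.antipode_left]
  rw [← IsComonHom.hom_counit f, Category.assoc, ← this, comp_conv, Category.comp_id]

end Braided

end NewmanHopf
end

noncomputable section

namespace NewmanHopf

variable {C : Type u} [Category.{v} C] [MonoidalCategory C]

/-! ### Twisting by an action -/

section Twist

/-- The endomorphism `d ⊗ z ↦ d₁ ⊗ g(d₂) z` of `D ⊗ Z`, where `D` is a comonoid and `Z` is a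
module over the target of `g`. -/
def twist {D A : C} [ComonObj D] [MonObj A] (g : D ⟶ A) (Z : C) [ModObj A Z] : D ⊗ Z ⟶ D ⊗ Z :=
  Δ[D] ▷ Z ≫ (α_ D D Z).hom ≫ D ◁ (g ▷ Z ≫ γ[A, Z])

variable {D A : C} [ComonObj D] [MonObj A] (Z : C) [ModObj A Z]

theorem twist_one : twist (ε[D] ≫ η[A]) Z = 𝟙 (D ⊗ Z) := by
  have h : Δ[D] ▷ Z ≫ (α_ D D Z).hom ≫ D ◁ ε[D] ▷ Z = (ρ_ D).inv ▷ Z ≫ (α_ D _ Z).hom := by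
    rw [← associator_naturality_middle, ← comp_whiskerRight_assoc, ComonObj.comul_counit]
  rw [twist, comp_whiskerRight, Category.assoc, ModObj.one_smul_self, whiskerLeft_comp,
    reassoc_of% h]
  simp

/-- Both sides are `d ⊗ z ↦ d₁ ⊗ g(d₂) f(d₃) z`, whence the reversed order. A convolution inverse of
`f` therefore gives an inverse of `twist f Z`. -/
theorem twist_comp_twist (f g : D ⟶ A) : twist f Z ≫ twist g Z = twist (conv g f) Z := by
  have key : Δ[D] ▷ (D ⊗ Z) ≫ (α_ D D (D ⊗ Z)).hom ≫ D ◁ D ◁ (f ▷ Z ≫ γ[A, Z]) ≫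
      D ◁ (g ▷ Z ≫ γ[A, Z]) = Δ[D] ▷ (D ⊗ Z) ≫ (α_ D D (D ⊗ Z)).hom ≫ D ◁ ((α_ D D Z).inv ≫
        ((g ⊗ₘ f) ≫ μ[A]) ▷ Z ≫ γ[A, Z]) := by
    congr 2
    rw [← whiskerLeft_comp]
    congr 1
    simp only [tensorHom_def', comp_whiskerRight, whiskerLeft_comp, Category.assoc,
      ModObj.mul_smul_self]
    rw [whisker_exchange_assoc]
    simp
  calc _ = Δ[D] ▷ Z ≫ (α_ D D Z).hom ≫ Δ[D] ▷ (D ⊗ Z) ≫ (α_ D D (D ⊗ Z)).hom ≫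
          D ◁ D ◁ (f ▷ Z ≫ γ[A, Z]) ≫ D ◁ (g ▷ Z ≫ γ[A, Z]) := by
        rw [twist, twist]
        simp only [Category.assoc]
        rw [whisker_exchange_assoc]
        congr 3
        rw [tensor_whiskerLeft]
        simp only [Category.assoc, Iso.inv_hom_id_assoc]
    _ = (Δ[D] ≫ Δ[D] ▷ D ≫ (α_ D D D).hom) ▷ Z ≫ (α_ D (D ⊗ D) Z).hom ≫
          D ◁ (((g ⊗ₘ f) ≫ μ[A]) ▷ Z ≫ γ[A, Z]) := by
        rw [key]
        simp only [comp_whiskerRight, Category.assoc, whiskerLeft_comp]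
        congr 1
        simp only [whiskerRight_tensor, Category.assoc]
        simp
    _ = _ := by
        rw [← ComonObj.comul_assoc, twist, conv, pair]
        simp [-ComonObj.comul_assoc]

theorem isIso_twist_of_conv {f g : D ⟶ A} (h : conv f g = ε[D] ≫ η[A])
    (h' : conv g f = ε[D] ≫ η[A]) : IsIso (twist f Z) :=
  ⟨twist g Z, by rw [twist_comp_twist, h', twist_one], by rw [twist_comp_twist, h, twist_one]⟩

theorem twist_natural {Z Z' : C} [ModObj A Z] [ModObj A Z'] (g : D ⟶ A) (f : Z ⟶ Z')
    (hf : γ[A, Z] ≫ f = A ◁ f ≫ γ[A, Z']) : D ◁ f ≫ twist g Z' = twist g Z ≫ D ◁ f := by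
  simp only [twist, Category.assoc]
  rw [whisker_exchange_assoc, tensor_whiskerLeft]
  simp only [Category.assoc, Iso.inv_hom_id_assoc, ← whiskerLeft_comp]
  rw [hf, whisker_exchange_assoc]

theorem twist_natural_comonHom {E : C} [ComonObj E] (h : E ⟶ D) [IsComonHom h] (g : D ⟶ A) :
    h ▷ Z ≫ twist g Z = twist (h ≫ g) Z ≫ h ▷ Z := by
  simp only [twist, Category.assoc]
  rw [← comp_whiskerRight_assoc, IsComonHom.hom_comul, MonoidalCategory.tensorHom_def]
  simp only [comp_whiskerRight, Category.assoc]
  rw [whisker_exchange, ← associator_naturality_left_assoc]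
  simp

theorem twist_whiskerRight {D B Z X : C} [ComonObj D] [MonObj B] [ModObj B Z] (g : D ⟶ B)
    (f : D ⟶ X) : twist g Z ≫ f ▷ Z = pair f g ▷ Z ≫ (α_ X B Z).hom ≫ X ◁ γ[B, Z] := by
  rw [twist, Category.assoc, Category.assoc, whisker_exchange,
    ← associator_naturality_left_assoc, pair, comp_whiskerRight, Category.assoc,
    MonoidalCategory.tensorHom_def]
  simp

end Twist

section TwistHopf

variable [BraidedCategory C]

theorem isIso_twist {D A : C} [ComonObj D] [HopfObj A] (g : D ⟶ A) [IsComonHom g]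
    (Z : C) [ModObj A Z] : IsIso (twist g Z) :=
  isIso_twist_of_conv Z (conv_antipode g) (antipode_conv g)

/-! ### The diagonal action on a tensor product -/

/-- The diagonal action of a bimonoid on the tensor product of two modules. -/
def diagAct (A X Y : C) [BimonObj A] [ModObj A X] [ModObj A Y] : A ⊗ X ⊗ Y ⟶ X ⊗ Y :=
  Δ[A] ▷ (X ⊗ Y) ≫ tensorμ A A X Y ≫ (γ[A, X] ⊗ₘ γ[A, Y])

theorem one_diagAct (A X Y : C) [BimonObj A] [ModObj A X] [ModObj A Y] :
    η[A] ▷ (X ⊗ Y) ≫ diagAct A X Y = (λ_ (X ⊗ Y)).hom := by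
  rw [diagAct, ← comp_whiskerRight_assoc, Bimon.one_comul, comp_whiskerRight_assoc,
    tensorμ_natural_left_assoc, tensorHom_comp_tensorHom, ModObj.one_smul_self,
    ModObj.one_smul_self, ← tensor_left_unitality]

theorem mul_diagAct (A X Y : C) [BimonObj A] [ModObj A X] [ModObj A Y] :
    μ[A] ▷ (X ⊗ Y) ≫ diagAct A X Y = (α_ A A (X ⊗ Y)).hom ≫ A ◁ diagAct A X Y ≫
      diagAct A X Y := by
  rw [diagAct, ← comp_whiskerRight_assoc, BimonObj.mul_comul]
  simp only [comp_whiskerRight, Category.assoc]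
  rw [tensorμ_natural_left_assoc, tensorHom_comp_tensorHom, ModObj.mul_smul_self,
    ModObj.mul_smul_self, ← tensorHom_comp_tensorHom, tensor_associativity_assoc,
    ← tensorHom_comp_tensorHom, ← tensorμ_natural_right_assoc]
  simp only [whiskerLeft_comp, Category.assoc, MonoidalCategory.tensorHom_def Δ[A]]
  rw [whisker_exchange_assoc, whisker_exchange_assoc, whisker_exchange_assoc]
  monoidal

/-- The tensor product of two modules over a bimonoid, with the diagonal action. -/
abbrev diagMod (A X Y : C) [BimonObj A] [ModObj A X] [ModObj A Y] : ModObj A (X ⊗ Y) where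
  smul := diagAct A X Y
  one_smul := one_diagAct A X Y
  mul_smul := mul_diagAct A X Y

theorem diagAct_natural {A X Y X' Y' : C} [BimonObj A] [ModObj A X] [ModObj A Y] [ModObj A X']
    [ModObj A Y'] (f : X ⟶ X') (g : Y ⟶ Y') (hf : γ[A, X] ≫ f = A ◁ f ≫ γ[A, X'])
    (hg : γ[A, Y] ≫ g = A ◁ g ≫ γ[A, Y']) :
    diagAct A X Y ≫ (f ⊗ₘ g) = A ◁ (f ⊗ₘ g) ≫ diagAct A X' Y' := by
  simp only [diagAct, Category.assoc, tensorHom_comp_tensorHom, hf, hg]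
  rw [← tensorHom_comp_tensorHom, ← tensorμ_natural_right_assoc, whisker_exchange_assoc]

/-- The diagonal action on `x ⊗ y` for `x` coming from the monoidal unit: `a (x ⊗ y) = a₁ x ⊗ a₂ y`,
and no braiding is involved. -/
theorem diagAct_unit {A X Y : C} [BimonObj A] [ModObj A X] [ModObj A Y] (x : 𝟙_ C ⟶ X) :
    A ◁ ((λ_ Y).inv ≫ x ▷ Y) ≫ diagAct A X Y =
      Δ[A] ▷ Y ≫ (α_ A A Y).hom ≫ (((ρ_ A).inv ≫ A ◁ x ≫ γ[A, X]) ⊗ₘ γ[A, Y]) := by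
  rw [diagAct, whisker_exchange_assoc, whiskerLeft_comp, Category.assoc, ← tensorHom_id x,
    tensorμ_natural_right_assoc, tensorHom_comp_tensorHom]
  congr 1
  have : (A ⊗ A) ◁ (λ_ Y).inv ≫ tensorμ A A (𝟙_ C) Y =
      (α_ A A Y).hom ≫ (ρ_ A).inv ▷ (A ⊗ Y) := by
    simp only [tensorμ, braiding_tensorUnit_right]
    monoidal
  rw [reassoc_of% this, whiskerLeft_id, Category.id_comp, ← tensorHom_id,
    tensorHom_comp_tensorHom, Category.id_comp]

end TwistHopf

end NewmanHopf
end

noncomputable section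

namespace NewmanHopf

/-! ### Transport of equalizers and coequalizers along isomorphisms of pairs. -/

section Transport

variable {C : Type u} [Category.{v} C]

theorem IsCoequalizerOf.comp_eq_comp_iff {X Y Z Z' T : C} {f g : X ⟶ Y} {p : Y ⟶ Z} {p' : Y ⟶ Z'}
    (h : IsCoequalizerOf f g p) (h' : IsCoequalizerOf f g p') (x y : T ⟶ Y) :
    x ≫ p = y ≫ p ↔ x ≫ p' = y ≫ p' := by
  obtain ⟨e, rfl⟩ := h.exists_iso h'
  simp [← Category.assoc]

theorem IsEqualizerOf.comp_eq_comp_iff {X X' Y Z T : C} {f g : Y ⟶ Z} {i : X ⟶ Y} {i' : X' ⟶ Y}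
    (h : IsEqualizerOf f g i) (h' : IsEqualizerOf f g i') (x y : Y ⟶ T) :
    i ≫ x = i ≫ y ↔ i' ≫ x = i' ≫ y := by
  obtain ⟨e, rfl⟩ := h.exists_iso h'
  simp

theorem IsCoequalizerOf.transport {X X' Y Y' Z : C} {f g : X ⟶ Y} {p : Y ⟶ Z}
    (h : IsCoequalizerOf f g p) {f' g' : X' ⟶ Y'} (a : X' ⟶ X) [Epi a] (t : Y' ⟶ Y) [IsIso t]
    (hf : f' ≫ t = a ≫ f) (hg : g' ≫ t = a ≫ g) : IsCoequalizerOf f' g' (t ≫ p) := by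
  have := h.epi
  refine ⟨inferInstance, by rw [reassoc_of% hf, reassoc_of% hg, h.w], fun s hs => ?_⟩
  obtain ⟨r, hr⟩ := h.desc (inv t ≫ s) (by
    rw [← cancel_epi a, ← reassoc_of% hf, ← reassoc_of% hg]
    simpa using hs)
  exact ⟨r, by simp [hr]⟩

theorem IsEqualizerOf.transport {X Y Y' Z Z' : C} {f g : Y ⟶ Z} {i : X ⟶ Y}
    (h : IsEqualizerOf f g i) {f' g' : Y' ⟶ Z'} (a : Z ⟶ Z') [Mono a] (t : Y ⟶ Y') [IsIso t]
    (hf : t ≫ f' = f ≫ a) (hg : t ≫ g' = g ≫ a) : IsEqualizerOf f' g' (i ≫ t) := by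
  have := h.mono
  refine ⟨inferInstance, by
    rw [Category.assoc, Category.assoc, hf, hg, reassoc_of% h.w], fun s hs => ?_⟩
  obtain ⟨r, hr⟩ := h.lift (s ≫ inv t) (by
    rw [← cancel_mono a, Category.assoc, Category.assoc, Category.assoc, Category.assoc, ← hf, ← hg]
    simpa using hs)
  exact ⟨r, by simp [reassoc_of% hr]⟩

theorem IsEqualizerOf.symm {X Y Z : C} {f g : Y ⟶ Z} {i : X ⟶ Y} (h : IsEqualizerOf f g i) :
    IsEqualizerOf g f i := ⟨h.mono, h.w.symm, fun t ht => h.lift t ht.symm⟩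

end Transport

variable {C : Type u} [Category.{v} C] [MonoidalCategory C]

section Preserves

variable {X Y Z : C}

theorem IsEqualizerOf.whiskerLeft {f g : Y ⟶ Z} {i : X ⟶ Y} (h : IsEqualizerOf f g i) (W : C)
    [PreservesLimitsOfShape WalkingParallelPair (tensorLeft W)] :
    IsEqualizerOf (W ◁ f) (W ◁ g) (W ◁ i) := h.map (tensorLeft W)

theorem IsEqualizerOf.whiskerRight {f g : Y ⟶ Z} {i : X ⟶ Y} (h : IsEqualizerOf f g i) (W : C)
    [PreservesLimitsOfShape WalkingParallelPair (tensorRight W)] :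
    IsEqualizerOf (f ▷ W) (g ▷ W) (i ▷ W) := h.map (tensorRight W)

theorem IsCoequalizerOf.whiskerLeft {f g : X ⟶ Y} {p : Y ⟶ Z} (h : IsCoequalizerOf f g p) (W : C)
    [PreservesColimitsOfShape WalkingParallelPair (tensorLeft W)] :
    IsCoequalizerOf (W ◁ f) (W ◁ g) (W ◁ p) := h.map (tensorLeft W)

theorem IsCoequalizerOf.whiskerRight {f g : X ⟶ Y} {p : Y ⟶ Z} (h : IsCoequalizerOf f g p) (W : C)
    [PreservesColimitsOfShape WalkingParallelPair (tensorRight W)] :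
    IsCoequalizerOf (f ▷ W) (g ▷ W) (p ▷ W) := h.map (tensorRight W)

theorem IsEqualizerOf.mono_tensorHom {X Y Z : C}
    [∀ X : C, PreservesLimitsOfShape WalkingParallelPair (tensorLeft X)]
    [∀ X : C, PreservesLimitsOfShape WalkingParallelPair (tensorRight X)]
    {f g : Y ⟶ Z} {i : X ⟶ Y} (h : IsEqualizerOf f g i) : Mono (i ⊗ₘ i) := by
  have := (h.whiskerRight X).mono
  have := (h.whiskerLeft Y).mono
  rw [MonoidalCategory.tensorHom_def]
  infer_instance

theorem IsCoequalizerOf.epi_tensorHom {X Y Z : C}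
    [∀ X : C, PreservesColimitsOfShape WalkingParallelPair (tensorLeft X)]
    [∀ X : C, PreservesColimitsOfShape WalkingParallelPair (tensorRight X)]
    {f g : X ⟶ Y} {p : Y ⟶ Z} (h : IsCoequalizerOf f g p) : Epi (p ⊗ₘ p) := by
  have := (h.whiskerRight Y).epi
  have := (h.whiskerLeft Z).epi
  rw [MonoidalCategory.tensorHom_def]
  infer_instance

end Preserves

variable [BraidedCategory C] {A K : CocHopf C} {Q : CocModComon A}

instance isComonHom_proj (p : CocModComon.regular A ⟶ Q) :
    IsComonHom (M := A.X) (CocModComon.proj p) :=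
  CocModComon.Hom.isComonHom p

theorem mul_proj (p : CocModComon.regular A ⟶ Q) :
    μ[A.X] ≫ CocModComon.proj p = A.X ◁ CocModComon.proj p ≫ γ[A.X, Q.X] :=
  CocModComon.Hom.linear p

theorem isPhi_iff (i : K ⟶ A) (p : CocModComon.regular A ⟶ Q) :
    IsPhi i p ↔ IsCoequalizerOf (A.X ◁ i.hom ≫ μ[A.X]) (fst A.X K.X) (CocModComon.proj p) :=
  isCoequalizerOf_iff.symm

theorem isPsi_iff (p : CocModComon.regular A ⟶ Q) (i : K ⟶ A) :
    IsPsi p i ↔ IsEqualizerOf (Δ[A.X] ≫ CocModComon.proj p ▷ A.X)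
      ((λ_ A.X).inv ≫ (η[A.X] ≫ CocModComon.proj p) ▷ A.X) i.hom :=
  isEqualizerOf_iff.symm

-- The shear, and the classes `𝓔` and `𝓠` as fixed points of `ψφ` and `φψ`.

attribute [local instance] ModObj.regular

/-- The automorphism `a ⊗ b ↦ a₁ ⊗ a₂ b` of `A ⊗ A`. -/
abbrev shear (A : CocHopf C) : A.X ⊗ A.X ⟶ A.X ⊗ A.X := twist (𝟙 A.X) A.X

instance (A : CocHopf C) : IsIso (shear A) := isIso_twist _ _

theorem shear_eq (A : CocHopf C) :
    shear A = Δ[A.X] ▷ A.X ≫ (α_ A.X A.X A.X).hom ≫ A.X ◁ μ[A.X] := by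
  rw [shear, twist, id_whiskerRight, Category.id_comp]
  rfl

/-- The relation defining `A ⊗_K A` corresponds under the shear to the relation defining
`φ(i) ⊗ A`. -/
theorem isCoequalizerOf_balanced {i : K ⟶ A} {p : CocModComon.regular A ⟶ Q}
    (h : IsPhi i p) [PreservesColimitsOfShape WalkingParallelPair (tensorRight A.X)] :
    IsCoequalizerOf ((A.X ◁ i.hom ≫ μ[A.X]) ▷ A.X)
      ((α_ A.X K.X A.X).hom ≫ A.X ◁ (i.hom ▷ A.X ≫ μ[A.X]))
      (shear A ≫ CocModComon.proj p ▷ A.X) := by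
  set g : A.X ⊗ K.X ⟶ A.X := A.X ◁ i.hom ≫ μ[A.X] with hg
  have : IsIso (twist g A.X) := isIso_twist _ _
  refine (((isPhi_iff i p).1 h).whiskerRight A.X).transport (twist g A.X) (shear A) ?_ ?_
  · rw [shear, twist_natural_comonHom, Category.comp_id]
  · have key : pair (fst A.X K.X) g = Δ[A.X] ▷ K.X ≫ (α_ _ _ _).hom ≫ A.X ◁ g := pair_fst g
    rw [twist_whiskerRight, key, shear_eq, hg]
    simp only [Category.assoc]
    rw [whisker_exchange_assoc]
    simp only [ModObj.smul_eq_mul, comp_whiskerRight, whiskerLeft_comp, Category.assoc]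
    simp
    rw [← whiskerLeft_comp, MonObj.mul_assoc_flip]
    simp only [whiskerLeft_comp]

/-- By `isCoequalizerOf_balanced`, `q` may be replaced by the shear followed by `p ⊗ 1`. The shear
fixes `1 ⊗ a` and sends `a ⊗ 1` to `a₁ ⊗ a₂`, so the two pairs equalize the same morphisms. -/
theorem isBalancedEqualizer_iff [HasCoequalizers C]
    [PreservesColimitsOfShape WalkingParallelPair (tensorRight A.X)]
    {i : K ⟶ A} {p : CocModComon.regular A ⟶ Q} (h : IsPhi i p) :
    IsBalancedEqualizer i ↔ IsPsi p i := by
  have hq : IsCoequalizerOf ((A.X ◁ i.hom ≫ μ[A.X]) ▷ A.X)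
      ((α_ A.X K.X A.X).hom ≫ A.X ◁ (i.hom ▷ A.X ≫ μ[A.X])) (balancedProj i) :=
    isCoequalizerOf_π _ _
  have h1 : (λ_ A.X).inv ≫ η[A.X] ▷ A.X ≫ shear A = (λ_ A.X).inv ≫ η[A.X] ▷ A.X := by
    rw [shear_eq, ← comp_whiskerRight_assoc, Bimon.one_comul, MonoidalCategory.tensorHom_def]
    simp only [comp_whiskerRight, Category.assoc, associator_naturality_middle_assoc,
      ← whiskerLeft_comp, MonObj.one_mul]
    rw [triangle, ← comp_whiskerRight (η[A.X] ▷ _), rightUnitor_naturality]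
    simp [← unitors_equal]
  have h2 : (ρ_ A.X).inv ≫ A.X ◁ η[A.X] ≫ shear A = Δ[A.X] := by
    rw [shear_eq, whisker_exchange_assoc, associator_naturality_right_assoc, ← whiskerLeft_comp,
      MonObj.mul_one]
    simp
  have key {T : C} (t : T ⟶ A.X) :
      t ≫ ((λ_ A.X).inv ≫ η[A.X] ▷ A.X ≫ balancedProj i) =
        t ≫ ((ρ_ A.X).inv ≫ A.X ◁ η[A.X] ≫ balancedProj i) ↔
      t ≫ (Δ[A.X] ≫ CocModComon.proj p ▷ A.X) =
        t ≫ ((λ_ A.X).inv ≫ (η[A.X] ≫ CocModComon.proj p) ▷ A.X) := by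
    have := hq.comp_eq_comp_iff (isCoequalizerOf_balanced h) (t ≫ (λ_ A.X).inv ≫ η[A.X] ▷ A.X)
      (t ≫ (ρ_ A.X).inv ≫ A.X ◁ η[A.X])
    simp only [Category.assoc] at this
    rw [this, reassoc_of% h1, reassoc_of% h2, comp_whiskerRight, eq_comm]
  rw [isPsi_iff, IsBalancedEqualizer, ← isEqualizerOf_iff]
  exact ⟨fun h => h.congr key, fun h => h.congr fun t => (key t).symm⟩

/-- The map `a ↦ p(a₁) ⊗ a₂` is linear for the diagonal action, because `Δ` and `p` are. The map `b
↦ p(1) ⊗ b` need not be; `diagAct_unit_proj` records that `a` sends `p(1) ⊗ b` to `p(a₁) ⊗ a₂ b`. -/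
theorem mul_comul_proj (p : CocModComon.regular A ⟶ Q) :
    μ[A.X] ≫ Δ[A.X] ≫ CocModComon.proj p ▷ A.X =
      A.X ◁ (Δ[A.X] ≫ CocModComon.proj p ▷ A.X) ≫ diagAct A.X Q.X A.X := by
  have h1 : μ[A.X] ≫ Δ[A.X] = A.X ◁ Δ[A.X] ≫ diagAct A.X A.X A.X :=
    (CocModComon.regular A).comul_linear
  have h2 := diagAct_natural (A := A.X) (X := A.X) (Y := A.X) (CocModComon.proj p) (𝟙 A.X)
    (mul_proj p) (by simp)
  rw [tensorHom_id] at h2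
  rw [reassoc_of% h1, h2, whiskerLeft_comp, Category.assoc]

theorem diagAct_unit_proj (p : CocModComon.regular A ⟶ Q) :
    A.X ◁ ((λ_ A.X).inv ≫ (η[A.X] ≫ CocModComon.proj p) ▷ A.X) ≫ diagAct A.X Q.X A.X =
      Δ[A.X] ▷ A.X ≫ (α_ _ _ _).hom ≫ (CocModComon.proj p ⊗ₘ μ[A.X]) := by
  have h2 : (ρ_ A.X).inv ≫ A.X ◁ (η[A.X] ≫ CocModComon.proj p) ≫ γ[A.X, Q.X] =
      CocModComon.proj p := by
    rw [whiskerLeft_comp, Category.assoc, ← mul_proj, MonObj.mul_one_assoc,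
      Iso.inv_hom_id_assoc]
  refine (diagAct_unit (A := A.X) (η[A.X] ≫ CocModComon.proj p)).trans ?_
  rw [h2]
  rfl

/-- The relation defining `A □_Q A` corresponds under the shear to the relation defining
`A ⊗ ψ(p)`. -/
theorem isEqualizerOf_cotensor {i : K ⟶ A} {p : CocModComon.regular A ⟶ Q}
    (h : IsPsi p i) [PreservesLimitsOfShape WalkingParallelPair (tensorLeft A.X)] :
    IsEqualizerOf
      ((Δ[A.X] ≫ A.X ◁ CocModComon.proj p) ▷ A.X ≫ (α_ A.X Q.X A.X).hom)
      (A.X ◁ (Δ[A.X] ≫ CocModComon.proj p ▷ A.X)) (A.X ◁ i.hom ≫ shear A) := by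
  let := diagMod A.X Q.X A.X
  have : IsIso (twist (𝟙 A.X) (Q.X ⊗ A.X)) := isIso_twist _ _
  -- On the target, the shear is matched by the twist for the diagonal action on `Q ⊗ A`. It sends
  -- `a ⊗ p(1) ⊗ b` to `a₁ ⊗ p(a₂) ⊗ a₃ b`, and it commutes with `b ↦ p(b₁) ⊗ b₂` by linearity. The
  -- pair occurs here in the opposite order to `IsPsi`, hence `symm`.
  refine (((isPsi_iff p i).1 h).symm.whiskerLeft A.X).transport
    (twist (𝟙 A.X) (Q.X ⊗ A.X)) (shear A) ?_ ?_
  · have h1 := diagAct_unit_proj p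
    change A.X ◁ _ ≫ γ[A.X, Q.X ⊗ A.X] = _ at h1
    rw [twist, id_whiskerRight, Category.id_comp, whisker_exchange_assoc, tensor_whiskerLeft,
      Category.assoc, Category.assoc, Iso.inv_hom_id_assoc, ← whiskerLeft_comp, h1, shear_eq]
    simp only [Category.assoc, comp_whiskerRight]
    rw [whisker_exchange_assoc]
    have h3 : Δ[A.X] ▷ A.X ≫ (α_ _ _ _).hom ≫ A.X ◁ Δ[A.X] ▷ A.X =
        Δ[A.X] ▷ A.X ≫ Δ[A.X] ▷ A.X ▷ A.X ≫ (α_ A.X A.X A.X).hom ▷ A.X ≫ (α_ _ _ _).hom := by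
      rw [← associator_naturality_middle, ← comp_whiskerRight_assoc, ComonObj.comul_assoc]
      simp
    rw [tensorHom_def', whiskerLeft_comp, reassoc_of% h3, ← associator_naturality_left_assoc]
    monoidal
  · exact (twist_natural _ _ (mul_comul_proj p)).symm

theorem shear_counit_left (A : CocHopf C) :
    shear A ≫ ε[A.X] ▷ A.X ≫ (λ_ A.X).hom = μ[A.X] := by
  rw [shear_eq, Category.assoc, Category.assoc, whisker_exchange_assoc,
    ← associator_naturality_left_assoc, ← comp_whiskerRight_assoc, ComonObj.counit_comul]
  simp

theorem shear_counit_right (i : K ⟶ A) :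
    A.X ◁ i.hom ≫ shear A ≫ A.X ◁ ε[A.X] ≫ (ρ_ A.X).hom = fst A.X K.X := by
  rw [shear_eq, fst]
  have h3 : μ[A.X] ≫ ε[A.X] = A.X ◁ ε[A.X] ≫ ε[A.X] ▷ 𝟙_ C ≫ (λ_ _).hom := by
    rw [Bimon.mul_counit, tensorHom_def', Category.assoc]
  simp only [Category.assoc]
  rw [← whiskerLeft_comp_assoc A.X μ[A.X], h3, whiskerLeft_comp_assoc,
    ← associator_naturality_right_assoc, ← whisker_exchange_assoc, ← whiskerLeft_comp_assoc,
    IsComonHom.hom_counit, whiskerLeft_comp, Category.assoc, ← associator_naturality_middle_assoc,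
    ← comp_whiskerRight_assoc, ComonObj.comul_counit]
  simp

/-- By `isEqualizerOf_cotensor`, the inclusion of `A □_Q A` may be replaced by `a ⊗ k ↦ a₁ ⊗ a₂ k`.
Applying `ε` to the first or to the second factor then gives `a k` or `a ε(k)`, the pair that
defines `φ(i)`. -/
theorem isCotensorCoequalizer_iff [HasEqualizers C]
    [PreservesLimitsOfShape WalkingParallelPair (tensorLeft A.X)]
    {i : K ⟶ A} {p : CocModComon.regular A ⟶ Q} (h : IsPsi p i) :
    IsCotensorCoequalizer p ↔ IsPhi i p := by
  have he : IsEqualizerOf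
      ((Δ[A.X] ≫ A.X ◁ CocModComon.proj p) ▷ A.X ≫ (α_ A.X Q.X A.X).hom)
      (A.X ◁ (Δ[A.X] ≫ CocModComon.proj p ▷ A.X)) (cotensorInclOf p) :=
    isEqualizerOf_ι _ _
  have h1 := shear_counit_left A
  have h2 := shear_counit_right i
  have key {T : C} (t : A.X ⟶ T) :
      (cotensorInclOf p ≫ ε[A.X] ▷ A.X ≫ (λ_ A.X).hom) ≫ t =
        (cotensorInclOf p ≫ A.X ◁ ε[A.X] ≫ (ρ_ A.X).hom) ≫ t ↔
      (A.X ◁ i.hom ≫ μ[A.X]) ≫ t = fst A.X K.X ≫ t := by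
    have := he.comp_eq_comp_iff (isEqualizerOf_cotensor h) ((ε[A.X] ▷ A.X ≫ (λ_ A.X).hom) ≫ t)
      ((A.X ◁ ε[A.X] ≫ (ρ_ A.X).hom) ≫ t)
    simp only [Category.assoc] at this ⊢
    rw [this, reassoc_of% h1, reassoc_of% h2]
  rw [isPhi_iff, IsCotensorCoequalizer, ← isCoequalizerOf_iff]
  exact ⟨fun h => h.congr key, fun h => h.congr fun t => (key t).symm⟩

end NewmanHopf
end

noncomputable section

namespace NewmanHopf

/-! ### Hopf structures on subobjects and quotients -/

variable {C : Type u} [Category.{v} C] [MonoidalCategory C]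

/-- A quotient `π : A ⟶ Q` in `C` of a comonoid `A` to which the structure
morphisms of `A` descend. -/
structure ComonQuot (A : C) [ComonObj A] where
  /-- The underlying object. -/
  X : C
  /-- The projection. -/
  π : A ⟶ X
  epi : Epi π
  epi_whiskerLeft (W : C) : Epi (W ◁ π)
  /-- The induced counit. -/
  counit : X ⟶ 𝟙_ C
  π_counit : π ≫ counit = ε[A]
  /-- The induced comultiplication. -/
  comul : X ⟶ X ⊗ X
  π_comul : π ≫ comul = Δ[A] ≫ (π ⊗ₘ π)

namespace ComonQuot

attribute [instance] epi epi_whiskerLeft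

variable {A : C} [ComonObj A] (Q : ComonQuot A)

instance comonObj : ComonObj Q.X where
  counit := Q.counit
  comul := Q.comul
  counit_comul := by
    rw [← cancel_epi Q.π, reassoc_of% @π_comul, tensorHom_def', Category.assoc, ← comp_whiskerRight,
      π_counit, whisker_exchange, ComonObj.counit_comul_assoc, leftUnitor_inv_naturality]
  comul_counit := by
    rw [← cancel_epi Q.π, reassoc_of% @π_comul, MonoidalCategory.tensorHom_def, Category.assoc,
      ← whiskerLeft_comp, π_counit, ← whisker_exchange, ComonObj.comul_counit_assoc,
      rightUnitor_inv_naturality]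
  comul_assoc := by
    rw [← cancel_epi Q.π]
    have h1 : (Q.π ⊗ₘ Q.π) ≫ Q.comul ▷ Q.X = Δ[A] ▷ A ≫ ((Q.π ⊗ₘ Q.π) ⊗ₘ Q.π) := by
      rw [← tensorHom_id, tensorHom_comp_tensorHom, π_comul, ← tensorHom_id,
        tensorHom_comp_tensorHom, Category.id_comp, Category.comp_id]
    have h2 : (Q.π ⊗ₘ Q.π) ≫ Q.X ◁ Q.comul = A ◁ Δ[A] ≫ (Q.π ⊗ₘ (Q.π ⊗ₘ Q.π)) := by
      rw [← id_tensorHom, tensorHom_comp_tensorHom, π_comul, ← id_tensorHom,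
        tensorHom_comp_tensorHom, Category.id_comp, Category.comp_id]
    rw [reassoc_of% @π_comul, reassoc_of% @π_comul, reassoc_of% h1, h2, associator_naturality,
      ComonObj.comul_assoc_assoc]

theorem comul_def : Δ[Q.X] = Q.comul := rfl
instance : IsComonHom Q.π where
  hom_counit := Q.π_counit
  hom_comul := Q.π_comul

end ComonQuot

variable [BraidedCategory C]

instance ComonQuot.isCommComonObj {A : C} [ComonObj A] (Q : ComonQuot A) [IsCommComonObj A] : IsCommComonObj Q.X where
  comul_comm := by
    rw [← cancel_epi Q.π, ComonQuot.comul_def, reassoc_of% @ComonQuot.π_comul, BraidedCategory.braiding_naturality,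
      IsCommComonObj.comul_comm_assoc, ComonQuot.π_comul]

section Sub

/-- A subobject `i : K ⟶ A` in `C` of a cocommutative Hopf monoid `A` to which the structure
morphisms of `A` restrict. -/
structure HopfSub (A : CocHopf C) where
  /-- The underlying object. -/
  X : C
  /-- The inclusion. -/
  incl : X ⟶ A.X
  mono : Mono incl
  mono_whiskerLeft (W : C) : Mono (W ◁ incl)
  mono_whiskerRight (W : C) : Mono (incl ▷ W)
  mono_whisker (V W : C) : Mono (V ◁ incl ▷ W)
  /-- The restricted unit. -/
  one : 𝟙_ C ⟶ X
  one_incl : one ≫ incl = η[A.X]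
  /-- The restricted multiplication. -/
  mul : X ⊗ X ⟶ X
  mul_incl : mul ≫ incl = (incl ⊗ₘ incl) ≫ μ[A.X]
  /-- The restricted comultiplication. -/
  comul : X ⟶ X ⊗ X
  comul_incl : comul ≫ (incl ⊗ₘ incl) = incl ≫ Δ[A.X]
  /-- The restricted antipode. -/
  antipode : X ⟶ X
  antipode_incl : antipode ≫ incl = incl ≫ 𝒮[A.X]

namespace HopfSub

attribute [instance] mono mono_whiskerLeft mono_whiskerRight mono_whisker

variable {A : CocHopf C} (K : HopfSub A)

instance : Mono (K.incl ⊗ₘ K.incl) := by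
  rw [MonoidalCategory.tensorHom_def]; infer_instance

instance : Mono (K.incl ⊗ₘ (K.incl ⊗ₘ K.incl)) := by
  rw [MonoidalCategory.tensorHom_def, MonoidalCategory.tensorHom_def, whiskerLeft_comp]
  have : Mono (A.X ◁ A.X ◁ K.incl) := by
    have : A.X ◁ A.X ◁ K.incl = (α_ _ _ _).inv ≫ (A.X ⊗ A.X) ◁ K.incl ≫ (α_ _ _ _).hom := by simp
    rw [this]
    infer_instance
  infer_instance

instance monObj : MonObj K.X where
  one := K.one
  mul := K.mul
  one_mul := by
    rw [← cancel_mono K.incl, Category.assoc, mul_incl, MonoidalCategory.tensorHom_def, Category.assoc,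
      ← comp_whiskerRight_assoc, one_incl, ← whisker_exchange_assoc, MonObj.one_mul,
      leftUnitor_naturality]
  mul_one := by
    rw [← cancel_mono K.incl, Category.assoc, mul_incl, tensorHom_def', Category.assoc,
      ← whiskerLeft_comp_assoc, one_incl, whisker_exchange_assoc, MonObj.mul_one,
      rightUnitor_naturality]
  mul_assoc := by
    rw [← cancel_mono K.incl]
    have h1 : K.mul ▷ K.X ≫ (K.incl ⊗ₘ K.incl) = ((K.incl ⊗ₘ K.incl) ⊗ₘ K.incl) ≫ μ[A.X] ▷ A.X := by
      rw [← tensorHom_id, tensorHom_comp_tensorHom, mul_incl, ← tensorHom_id,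
        tensorHom_comp_tensorHom, Category.id_comp, Category.comp_id]
    have h2 : K.X ◁ K.mul ≫ (K.incl ⊗ₘ K.incl) = (K.incl ⊗ₘ (K.incl ⊗ₘ K.incl)) ≫ A.X ◁ μ[A.X] := by
      rw [← id_tensorHom, tensorHom_comp_tensorHom, mul_incl, ← id_tensorHom,
        tensorHom_comp_tensorHom, Category.id_comp, Category.comp_id]
    simp only [Category.assoc, mul_incl]
    rw [reassoc_of% h1, reassoc_of% h2, MonObj.mul_assoc, associator_naturality_assoc]

instance comonObj : ComonObj K.X where
  counit := K.incl ≫ ε[A.X]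
  comul := K.comul
  counit_comul := by
    rw [← cancel_mono (𝟙_ C ◁ K.incl), Category.assoc, comp_whiskerRight, Category.assoc,
      ← whisker_exchange, ← tensorHom_def_assoc, reassoc_of% @comul_incl, ComonObj.counit_comul,
      leftUnitor_inv_naturality]
  comul_counit := by
    rw [← cancel_mono (K.incl ▷ 𝟙_ C), Category.assoc, whiskerLeft_comp, Category.assoc,
      whisker_exchange, ← tensorHom_def'_assoc, reassoc_of% @comul_incl, ComonObj.comul_counit,
      rightUnitor_inv_naturality]
  comul_assoc := by
    rw [← cancel_mono (K.incl ⊗ₘ (K.incl ⊗ₘ K.incl))]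
    have h1 : K.comul ▷ K.X ≫ ((K.incl ⊗ₘ K.incl) ⊗ₘ K.incl) = (K.incl ⊗ₘ K.incl) ≫ Δ[A.X] ▷ A.X := by
      rw [← tensorHom_id, tensorHom_comp_tensorHom, comul_incl, ← tensorHom_id,
        tensorHom_comp_tensorHom, Category.id_comp, Category.comp_id]
    have h2 : K.X ◁ K.comul ≫ (K.incl ⊗ₘ (K.incl ⊗ₘ K.incl)) = (K.incl ⊗ₘ K.incl) ≫ A.X ◁ Δ[A.X] := by
      rw [← id_tensorHom, tensorHom_comp_tensorHom, comul_incl, ← id_tensorHom,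
        tensorHom_comp_tensorHom, Category.id_comp, Category.comp_id]
    simp only [Category.assoc]
    rw [← associator_naturality, reassoc_of% h1, h2, reassoc_of% @comul_incl, reassoc_of% @comul_incl,
      ComonObj.comul_assoc]

theorem mul_def : μ[K.X] = K.mul := rfl
theorem one_def : η[K.X] = K.one := rfl
theorem comul_def : Δ[K.X] = K.comul := rfl
theorem counit_def : ε[K.X] = K.incl ≫ ε[A.X] := rfl

instance bimonObj : BimonObj K.X where
  mul_comul := by
    rw [← cancel_mono (K.incl ⊗ₘ K.incl), mul_def, comul_def]
    simp only [Category.assoc, comul_incl, tensorHom_comp_tensorHom, mul_incl, reassoc_of% @mul_incl,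
      BimonObj.mul_comul]
    rw [← tensorHom_comp_tensorHom, ← tensorμ_natural_assoc, tensorHom_comp_tensorHom_assoc,
      tensorHom_comp_tensorHom_assoc, comul_incl]
  one_comul := by
    rw [← cancel_mono (K.incl ⊗ₘ K.incl), MonObj.tensorObj.one_def, one_def, comul_def]
    simp only [Category.assoc, comul_incl, tensorHom_comp_tensorHom, one_incl, reassoc_of% @one_incl,
      Bimon.one_comul]
  mul_counit := by
    rw [Comon.tensorObj_counit, mul_def, counit_def, reassoc_of% @mul_incl, Bimon.mul_counit,
      tensorHom_comp_tensorHom_assoc]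
  one_counit := by
    rw [one_def, counit_def, reassoc_of% @one_incl, BimonObj.one_counit]

instance hopfObj : HopfObj K.X where
  antipode := K.antipode
  antipode_left := by
    rw [← cancel_mono K.incl, mul_def, comul_def, counit_def, one_def]
    simp only [Category.assoc, mul_incl, one_incl]
    have : K.antipode ▷ K.X ≫ (K.incl ⊗ₘ K.incl) = (K.incl ⊗ₘ K.incl) ≫ 𝒮[A.X] ▷ A.X := by
      rw [← tensorHom_id, tensorHom_comp_tensorHom, antipode_incl, ← tensorHom_id,
        tensorHom_comp_tensorHom, Category.id_comp, Category.comp_id]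
    rw [reassoc_of% this, reassoc_of% @comul_incl, HopfObj.antipode_left]
  antipode_right := by
    rw [← cancel_mono K.incl, mul_def, comul_def, counit_def, one_def]
    simp only [Category.assoc, mul_incl, one_incl]
    have : K.X ◁ K.antipode ≫ (K.incl ⊗ₘ K.incl) = (K.incl ⊗ₘ K.incl) ≫ A.X ◁ 𝒮[A.X] := by
      rw [← id_tensorHom, tensorHom_comp_tensorHom, antipode_incl, ← id_tensorHom,
        tensorHom_comp_tensorHom, Category.id_comp, Category.comp_id]
    rw [reassoc_of% this, reassoc_of% @comul_incl, HopfObj.antipode_right]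

instance isCommComonObj : IsCommComonObj K.X where
  comul_comm := by
    rw [← cancel_mono (K.incl ⊗ₘ K.incl), comul_def, Category.assoc,
      ← BraidedCategory.braiding_naturality, reassoc_of% @comul_incl, IsCommComonObj.comul_comm, comul_incl]

/-- The cocommutative Hopf monoid underlying a Hopf subobject. -/
def toCocHopf : CocHopf C where
  X := K.X

/-- The inclusion of a Hopf subobject. -/
def inclHom : K.toCocHopf ⟶ A where
  hom := K.incl
  isBimonHom :=
    { one_hom := K.one_incl
      mul_hom := K.mul_incl
      hom_counit := rfl
      hom_comul := K.comul_incl.symm }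

end HopfSub

end Sub

section Quot

/-- An epimorphism of comonoids `π : A ⟶ Q` to which the multiplication, the unit and the antipode
of the cocommutative Hopf monoid `A` descend. -/
structure HopfQuot (A : CocHopf C) where
  /-- The underlying object. -/
  X : C
  [comon : ComonObj X]
  [comm : IsCommComonObj X]
  /-- The projection. -/
  π : A.X ⟶ X
  [isComonHom : IsComonHom π]
  epi : Epi π
  epi_whiskerLeft (W : C) : Epi (W ◁ π)
  epi_whiskerRight (W : C) : Epi (π ▷ W)
  epi_whisker (V W : C) : Epi ((V ◁ π) ▷ W)
  /-- The induced multiplication. -/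
  mul : X ⊗ X ⟶ X
  π_mul : (π ⊗ₘ π) ≫ mul = μ[A.X] ≫ π
  /-- The induced antipode. -/
  antipode : X ⟶ X
  π_antipode : π ≫ antipode = 𝒮[A.X] ≫ π

namespace HopfQuot

attribute [instance] epi epi_whiskerLeft epi_whiskerRight epi_whisker comon comm isComonHom

variable {A : CocHopf C} (Q : HopfQuot A)

instance : Epi (Q.π ⊗ₘ Q.π) := by
  rw [MonoidalCategory.tensorHom_def]; infer_instance

instance : Epi ((Q.π ⊗ₘ Q.π) ⊗ₘ Q.π) := by
  rw [MonoidalCategory.tensorHom_def, MonoidalCategory.tensorHom_def, comp_whiskerRight]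
  have : Epi (Q.π ▷ A.X ▷ A.X) := by
    have : Q.π ▷ A.X ▷ A.X = (α_ _ _ _).hom ≫ Q.π ▷ (A.X ⊗ A.X) ≫ (α_ _ _ _).inv := by simp
    rw [this]
    infer_instance
  infer_instance

instance monObj : MonObj Q.X where
  one := η[A.X] ≫ Q.π
  mul := Q.mul
  one_mul := by
    rw [← cancel_epi (𝟙_ C ◁ Q.π), comp_whiskerRight, Category.assoc, whisker_exchange_assoc,
      ← tensorHom_def'_assoc, π_mul, MonObj.one_mul_assoc, leftUnitor_naturality]
  mul_one := by
    rw [← cancel_epi (Q.π ▷ 𝟙_ C), whiskerLeft_comp, Category.assoc, ← whisker_exchange_assoc,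
      ← MonoidalCategory.tensorHom_def_assoc, π_mul, MonObj.mul_one_assoc, rightUnitor_naturality]
  mul_assoc := by
    rw [← cancel_epi ((Q.π ⊗ₘ Q.π) ⊗ₘ Q.π)]
    have h1 : ((Q.π ⊗ₘ Q.π) ⊗ₘ Q.π) ≫ Q.mul ▷ Q.X = μ[A.X] ▷ A.X ≫ (Q.π ⊗ₘ Q.π) := by
      rw [← tensorHom_id, tensorHom_comp_tensorHom, π_mul, ← tensorHom_id,
        tensorHom_comp_tensorHom, Category.id_comp, Category.comp_id]
    have h2 : (Q.π ⊗ₘ (Q.π ⊗ₘ Q.π)) ≫ Q.X ◁ Q.mul = A.X ◁ μ[A.X] ≫ (Q.π ⊗ₘ Q.π) := by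
      rw [← id_tensorHom, tensorHom_comp_tensorHom, π_mul, ← id_tensorHom,
        tensorHom_comp_tensorHom, Category.id_comp, Category.comp_id]
    rw [reassoc_of% h1, π_mul, associator_naturality_assoc, reassoc_of% h2, π_mul,
      MonObj.mul_assoc_assoc]

theorem mul_def : μ[Q.X] = Q.mul := rfl
theorem one_def : η[Q.X] = η[A.X] ≫ Q.π := rfl

instance bimonObj : BimonObj Q.X where
  mul_comul := by
    rw [← cancel_epi (Q.π ⊗ₘ Q.π), mul_def, reassoc_of% @π_mul, IsComonHom.hom_comul,
      BimonObj.mul_comul_assoc]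
    simp only [tensorHom_comp_tensorHom_assoc, tensorHom_comp_tensorHom, IsComonHom.hom_comul,
      ← π_mul]
    rw [← tensorHom_comp_tensorHom, ← tensorHom_comp_tensorHom_assoc, tensorμ_natural_assoc]
  one_comul := by
    rw [MonObj.tensorObj.one_def, one_def, Category.assoc, IsComonHom.hom_comul,
      Bimon.one_comul_assoc, tensorHom_comp_tensorHom]
  mul_counit := by
    rw [← cancel_epi (Q.π ⊗ₘ Q.π), Comon.tensorObj_counit, mul_def, reassoc_of% @π_mul,
      tensorHom_comp_tensorHom_assoc, IsComonHom.hom_counit, Bimon.mul_counit]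
  one_counit := by
    rw [one_def, Category.assoc, IsComonHom.hom_counit, BimonObj.one_counit]

instance hopfObj : HopfObj Q.X where
  antipode := Q.antipode
  antipode_left := by
    rw [← cancel_epi Q.π, mul_def, one_def, IsComonHom.hom_comul_assoc]
    have : (Q.π ⊗ₘ Q.π) ≫ Q.antipode ▷ Q.X = 𝒮[A.X] ▷ A.X ≫ (Q.π ⊗ₘ Q.π) := by
      rw [← tensorHom_id, tensorHom_comp_tensorHom, π_antipode, ← tensorHom_id,
        tensorHom_comp_tensorHom, Category.id_comp, Category.comp_id]
    rw [reassoc_of% this, π_mul, HopfObj.antipode_left_assoc,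
      IsComonHom.hom_counit_assoc]
  antipode_right := by
    rw [← cancel_epi Q.π, mul_def, one_def, IsComonHom.hom_comul_assoc]
    have : (Q.π ⊗ₘ Q.π) ≫ Q.X ◁ Q.antipode = A.X ◁ 𝒮[A.X] ≫ (Q.π ⊗ₘ Q.π) := by
      rw [← id_tensorHom, tensorHom_comp_tensorHom, π_antipode, ← id_tensorHom,
        tensorHom_comp_tensorHom, Category.id_comp, Category.comp_id]
    rw [reassoc_of% this, π_mul, HopfObj.antipode_right_assoc,
      IsComonHom.hom_counit_assoc]

/-- The cocommutative Hopf monoid underlying a Hopf quotient. -/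
def toCocHopf : CocHopf C where
  X := Q.X

/-- The projection onto a Hopf quotient. -/
def projHom : A ⟶ Q.toCocHopf where
  hom := Q.π
  isBimonHom :=
    { one_hom := rfl
      mul_hom := Q.π_mul.symm
      hom_counit := IsComonHom.hom_counit Q.π
      hom_comul := IsComonHom.hom_comul Q.π }

end HopfQuot

end Quot

end NewmanHopf
end

noncomputable section

namespace NewmanHopf

variable {C : Type u} [Category.{v} C] [MonoidalCategory C] [BraidedCategory C]

attribute [local instance] ModObj.regular

/-! ### Existence of `ψ` -/

section Psi

variable {A : CocHopf C} {Q : CocModComon A} (p : CocModComon.regular A ⟶ Q)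

/-- The morphism `a ↦ p(a₁) ⊗ a₂`. -/
def psiLeft : A.X ⟶ Q.X ⊗ A.X := Δ[A.X] ≫ CocModComon.proj p ▷ A.X

/-- The morphism `a ↦ p(1) ⊗ a`. -/
def psiRight : A.X ⟶ Q.X ⊗ A.X := (λ_ A.X).inv ≫ (η[A.X] ≫ CocModComon.proj p) ▷ A.X

theorem one_psi : η[A.X] ≫ psiLeft p = η[A.X] ≫ psiRight p := by
  rw [psiLeft, psiRight, Bimon.one_comul_assoc, leftUnitor_inv_naturality_assoc,
    tensorHom_def', Category.assoc, comp_whiskerRight]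

/-- `psiLeft` and `psiRight` are both morphisms of right `A`-comodules, so `Δ` maps their equalizer
`K` into `K ⊗ A`. -/
theorem comul_psiLeft : Δ[A.X] ≫ psiLeft p ▷ A.X ≫ (α_ _ _ _).hom = psiLeft p ≫ Q.X ◁ Δ[A.X] := by
  rw [psiLeft, comp_whiskerRight, Category.assoc, Category.assoc, associator_naturality_left,
    ← ComonObj.comul_assoc_assoc, whisker_exchange]

theorem comul_psiRight :
    Δ[A.X] ≫ psiRight p ▷ A.X ≫ (α_ _ _ _).hom = psiRight p ≫ Q.X ◁ Δ[A.X] := by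
  rw [psiRight, Category.assoc, ← whisker_exchange, ← leftUnitor_inv_naturality_assoc]
  simp

variable {p} {K : C} {i : K ⟶ A.X} (h : i ≫ psiLeft p = i ≫ psiRight p)
include h

theorem comul_psi_whiskerRight :
    (i ≫ Δ[A.X]) ≫ psiLeft p ▷ A.X = (i ≫ Δ[A.X]) ≫ psiRight p ▷ A.X := by
  rw [← cancel_mono (α_ _ _ _).hom]
  simp only [Category.assoc]
  rw [comul_psiLeft, comul_psiRight, reassoc_of% h]

/-- Cocommutativity inserts a braiding after `Δ`, whose naturality moves the previous relation to
the other tensor factor. -/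
theorem comul_psi_whiskerLeft :
    (i ≫ Δ[A.X]) ≫ A.X ◁ psiLeft p = (i ≫ Δ[A.X]) ≫ A.X ◁ psiRight p := by
  have h1 : (i ≫ Δ[A.X]) = (i ≫ Δ[A.X]) ≫ (β_ A.X A.X).hom := by
    rw [Category.assoc, IsCommComonObj.comul_comm]
  rw [h1, Category.assoc, Category.assoc _ _ (A.X ◁ psiRight p),
    ← BraidedCategory.braiding_naturality_left, ← BraidedCategory.braiding_naturality_left,
    ← Category.assoc, comul_psi_whiskerRight h, Category.assoc]

/-- For `k`, `l` in `K`, linearity gives `p(k₁ l₁) ⊗ k₂ l₂ = k · (p(l₁) ⊗ l₂) = k · (p(1) ⊗ l) =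
p(k₁) ⊗ k₂ l = p(1) ⊗ k l`. -/
theorem mul_psi : (i ⊗ₘ i) ≫ μ[A.X] ≫ psiLeft p = (i ⊗ₘ i) ≫ μ[A.X] ≫ psiRight p := by
  have h1 : (i ⊗ₘ i) ≫ A.X ◁ psiLeft p = (i ⊗ₘ i) ≫ A.X ◁ psiRight p := by
    rw [← id_tensorHom, ← id_tensorHom, tensorHom_comp_tensorHom, tensorHom_comp_tensorHom, h]
  have h2 : (i ⊗ₘ i) ≫ psiLeft p ▷ A.X = (i ⊗ₘ i) ≫ psiRight p ▷ A.X := by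
    rw [← tensorHom_id, ← tensorHom_id, tensorHom_comp_tensorHom, tensorHom_comp_tensorHom, h]
  have h3 : Δ[A.X] ▷ A.X ≫ (α_ _ _ _).hom ≫ (CocModComon.proj p ⊗ₘ μ[A.X]) =
      psiLeft p ▷ A.X ≫ (α_ _ _ _).hom ≫ Q.X ◁ μ[A.X] := by
    simp [MonoidalCategory.tensorHom_def, psiLeft]
  have h4 : psiRight p ▷ A.X ≫ (α_ _ _ _).hom ≫ Q.X ◁ μ[A.X] = μ[A.X] ≫ psiRight p := by
    rw [psiRight, leftUnitor_inv_naturality_assoc, whisker_exchange]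
    simp
  have h5 : μ[A.X] ≫ psiLeft p = A.X ◁ psiLeft p ≫ diagAct A.X Q.X A.X := mul_comul_proj p
  have h6 := diagAct_unit_proj p
  change A.X ◁ psiRight p ≫ _ = _ at h6
  rw [h5, reassoc_of% h1, h6, h3, reassoc_of% h2, h4]

/-- Since `p(S a) = S(a) · p(1)`, for `k` in `K` one has `p(S k₁) ⊗ k₂ = S(k₁) · p(1) ⊗ k₂ = S(k₁) ·
p(k₂) ⊗ k₃ = p(1) ⊗ k`. Applying `S` to the second factor concludes, because `S` is a comonoid
morphism by cocommutativity. -/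
theorem antipode_psi : i ≫ 𝒮[A.X] ≫ psiLeft p = i ≫ 𝒮[A.X] ≫ psiRight p := by
  have h1 : 𝒮[A.X] ≫ CocModComon.proj p =
      (ρ_ A.X).inv ≫ A.X ◁ (η[A.X] ≫ CocModComon.proj p) ≫ 𝒮[A.X] ▷ Q.X ≫ γ[A.X, Q.X] := by
    rw [whisker_exchange_assoc, whiskerLeft_comp, Category.assoc, ← mul_proj, MonObj.mul_one_assoc]
    simp
  have h2 : Δ[A.X] ≫ A.X ◁ CocModComon.proj p ≫ 𝒮[A.X] ▷ Q.X ≫ γ[A.X, Q.X] =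
      ε[A.X] ≫ η[A.X] ≫ CocModComon.proj p := by
    rw [whisker_exchange_assoc, ← mul_proj, HopfObj.antipode_left_assoc]
  have h3 : Δ[A.X] ≫ (𝒮[A.X] ≫ CocModComon.proj p) ▷ A.X =
      Δ[A.X] ≫ A.X ◁ psiRight p ≫ (α_ _ _ _).inv ≫ (𝒮[A.X] ▷ Q.X ≫ γ[A.X, Q.X]) ▷ A.X := by
    rw [h1, psiRight]
    simp
  have h4 : Δ[A.X] ≫ A.X ◁ psiLeft p ≫ (α_ _ _ _).inv ≫ (𝒮[A.X] ▷ Q.X ≫ γ[A.X, Q.X]) ▷ A.X =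
      psiRight p := by
    have h5 : Δ[A.X] ≫ A.X ◁ Δ[A.X] ≫ (α_ _ _ _).inv = Δ[A.X] ≫ Δ[A.X] ▷ A.X := by
      rw [ComonObj.comul_assoc_assoc, Iso.hom_inv_id, Category.comp_id]
    rw [psiLeft, psiRight, whiskerLeft_comp, Category.assoc, associator_inv_naturality_middle_assoc,
      reassoc_of% h5, ← comp_whiskerRight, ← comp_whiskerRight, h2, comp_whiskerRight,
      ComonObj.counit_comul_assoc]
  have h5 : i ≫ Δ[A.X] ≫ (𝒮[A.X] ≫ CocModComon.proj p) ▷ A.X = i ≫ psiRight p := by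
    have := comul_psi_whiskerLeft h
    simp only [Category.assoc] at this
    rw [h3, ← reassoc_of% this, h4]
  rw [psiLeft, IsComonHom.hom_comul_assoc, tensorHom_def', Category.assoc, ← comp_whiskerRight,
    whisker_exchange, reassoc_of% h5, psiRight, Category.assoc, ← whisker_exchange,
    leftUnitor_inv_naturality_assoc, leftUnitor_inv_naturality_assoc, leftUnitor_inv_naturality_assoc]

end Psi

section PsiExists

variable {A : CocHopf C} {Q : CocModComon A} [HasEqualizers C]
  [∀ X : C, PreservesLimitsOfShape WalkingParallelPair (tensorLeft X)]
  [∀ X : C, PreservesLimitsOfShape WalkingParallelPair (tensorRight X)]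

theorem exists_isPsi (p : CocModComon.regular A ⟶ Q) :
    ∃ (K : CocHopf C) (i : K ⟶ A), IsPsi p i := by
  obtain ⟨K, i, h⟩ : ∃ (K : C) (i : K ⟶ A.X), IsEqualizerOf (psiLeft p) (psiRight p) i :=
    ⟨_, _, isEqualizerOf_ι _ _⟩
  obtain ⟨one, h_one⟩ := h.lift η[A.X] (one_psi p)
  obtain ⟨mul, h_mul⟩ := h.lift ((i ⊗ₘ i) ≫ μ[A.X]) (by
    rw [Category.assoc, Category.assoc, mul_psi h.w])
  obtain ⟨antipode, h_antipode⟩ := h.lift (i ≫ 𝒮[A.X]) (by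
    rw [Category.assoc, Category.assoc, antipode_psi h.w])
  -- The comultiplication is restricted in two stages, first into `K ⊗ A` and then into `K ⊗ K`. The
  -- relation needed for the second stage is tested after the monomorphism `i ⊗ 1`.
  obtain ⟨c, hc⟩ := (h.whiskerRight A.X).lift (i ≫ Δ[A.X]) (comul_psi_whiskerRight h.w)
  have := (h.whiskerRight (Q.X ⊗ A.X)).mono
  obtain ⟨comul, h_comul⟩ := (h.whiskerLeft K).lift c (by
    rw [← cancel_mono (i ▷ (Q.X ⊗ A.X)), Category.assoc, Category.assoc, whisker_exchange,
      whisker_exchange, reassoc_of% hc, reassoc_of% hc]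
    simpa using comul_psi_whiskerLeft h.w)
  let S : HopfSub A :=
    { X := K
      incl := i
      mono := h.mono
      mono_whiskerLeft := fun W => (h.whiskerLeft W).mono
      mono_whiskerRight := fun W => (h.whiskerRight W).mono
      mono_whisker := fun V W => ((h.whiskerRight W).whiskerLeft V).mono
      one := one
      one_incl := h_one
      mul := mul
      mul_incl := h_mul
      comul := comul
      comul_incl := by rw [tensorHom_def', reassoc_of% h_comul, hc]
      antipode := antipode
      antipode_incl := h_antipode }
  exact ⟨S.toCocHopf, S.inclHom, (isPsi_iff p S.inclHom).2 h⟩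

end PsiExists

/-! ### Existence of `φ` -/

section ToCocModComon

variable {A : CocHopf C} (S : ComonQuot A.X) (act : A.X ⊗ S.X ⟶ S.X)
  (h_act : A.X ◁ S.π ≫ act = μ[A.X] ≫ S.π)

/-- The action of `A` on a quotient to which the multiplication of `A` descends. -/
abbrev ComonQuot.modObj : ModObj A.X S.X where
  smul := act
  one_smul := by
    change η[A.X] ▷ S.X ≫ act = (λ_ S.X).hom
    rw [← cancel_epi (𝟙_ C ◁ S.π), whisker_exchange_assoc, h_act, MonObj.one_mul_assoc,
      leftUnitor_naturality]
  mul_smul := by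
    change μ[A.X] ▷ S.X ≫ act = (α_ _ _ _).hom ≫ A.X ◁ act ≫ act
    rw [← cancel_epi ((A.X ⊗ A.X) ◁ S.π), whisker_exchange_assoc, h_act,
      MonObj.mul_assoc_assoc, associator_naturality_right_assoc, ← whiskerLeft_comp_assoc,
      h_act, whiskerLeft_comp_assoc, h_act]

/-- A quotient comonoid to which the multiplication of `A` descends is a comonoid in left
`A`-modules. -/
def ComonQuot.toCocModComon : CocModComon A :=
  letI := S.modObj act h_act
  have hlin : μ[A.X] ≫ S.π = A.X ◁ S.π ≫ γ[A.X, S.X] := h_act.symm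
  { X := S.X
    comul_linear := by
      have h1 := diagAct_natural (A := A.X) (X := A.X) (Y := A.X) S.π S.π hlin hlin
      have h2 : μ[A.X] ≫ Δ[A.X] = A.X ◁ Δ[A.X] ≫ diagAct A.X A.X A.X :=
        (CocModComon.regular A).comul_linear
      change _ = A.X ◁ Δ[S.X] ≫ diagAct A.X S.X S.X
      rw [← cancel_epi (A.X ◁ S.π), ← reassoc_of% hlin, IsComonHom.hom_comul, reassoc_of% h2,
        h1, ← whiskerLeft_comp_assoc, ← whiskerLeft_comp_assoc, IsComonHom.hom_comul]
    counit_linear := by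
      rw [← cancel_epi (A.X ◁ S.π), ← reassoc_of% hlin, IsComonHom.hom_counit S.π,
        ← whiskerLeft_comp_assoc, IsComonHom.hom_counit S.π]
      exact (CocModComon.regular A).counit_linear }

/-- The projection from `A` to a quotient comonoid in left `A`-modules. -/
def ComonQuot.toCocModComonHom : CocModComon.regular A ⟶ S.toCocModComon act h_act where
  hom := S.π
  isComonHom := inferInstanceAs (IsComonHom S.π)
  linear := h_act.symm

end ToCocModComon

section PhiExists

variable {A K : CocHopf C} [HasCoequalizers C]
  [∀ X : C, PreservesColimitsOfShape WalkingParallelPair (tensorLeft X)]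

/-- The parallel maps `a ⊗ k ↦ a k` and `a ⊗ k ↦ a ε(k)` are both left `A`-linear comonoid
morphisms, so the comonoid structure and the action of `A` descend to their coequalizer. -/
theorem exists_isPhi (i : K ⟶ A) :
    ∃ (Q : CocModComon A) (p : CocModComon.regular A ⟶ Q), IsPhi i p := by
  have hg : IsComonHom (A.X ◁ i.hom ≫ μ[A.X]) := inferInstance
  have hgl : A.X ◁ (A.X ◁ i.hom ≫ μ[A.X]) ≫ μ[A.X] =
      (α_ _ _ _).inv ≫ μ[A.X] ▷ K.X ≫ A.X ◁ i.hom ≫ μ[A.X] := by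
    rw [← whisker_exchange_assoc]
    simp
  have hel : A.X ◁ fst A.X K.X ≫ μ[A.X] = (α_ _ _ _).inv ≫ μ[A.X] ▷ K.X ≫ fst A.X K.X := by
    rw [fst, ← whisker_exchange_assoc, rightUnitor_naturality]
    simp
  obtain ⟨Q, p, h⟩ : ∃ (Q : C) (p : A.X ⟶ Q),
      IsCoequalizerOf (A.X ◁ i.hom ≫ μ[A.X]) (fst A.X K.X) p := ⟨_, _, isCoequalizerOf_π _ _⟩
  have hφ := h
  generalize A.X ◁ i.hom ≫ μ[A.X] = g at hg hgl h
  obtain ⟨counit, h_counit⟩ := h.desc ε[A.X] (by simp only [IsComonHom.hom_counit])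
  obtain ⟨comul, h_comul⟩ := h.desc (Δ[A.X] ≫ (p ⊗ₘ p)) (by
    simp only [IsComonHom.hom_comul_assoc, tensorHom_comp_tensorHom, h.w])
  obtain ⟨act, h_act⟩ := (h.whiskerLeft A.X).desc (μ[A.X] ≫ p) (by
    rw [reassoc_of% hgl, reassoc_of% hel, h.w])
  let S : ComonQuot A.X :=
    { X := Q
      π := p
      epi := h.epi
      epi_whiskerLeft := fun W => (h.whiskerLeft W).epi
      counit := counit
      π_counit := h_counit
      comul := comul
      π_comul := h_comul }
  exact ⟨S.toCocModComon act h_act, S.toCocModComonHom act h_act,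
    (isPhi_iff i (S.toCocModComonHom act h_act)).2 hφ⟩

end PhiExists

end NewmanHopf
end

noncomputable section

namespace NewmanHopf

variable {C : Type u} [Category.{v} C] [MonoidalCategory C] [BraidedCategory C]

attribute [local instance] ModObj.regular

/-! ### Universal properties of `φ` and `ψ` -/

section

variable {A K : CocHopf C} {Q Q' : CocModComon A}

/-- Apply `ε` to the second factor of `p(k₁) ⊗ k₂ = p(1) ⊗ k`. -/
theorem IsPsi.comp_proj {p : CocModComon.regular A ⟶ Q} {i : K ⟶ A} (h : IsPsi p i) :
    i.hom ≫ CocModComon.proj p = ε[K.X] ≫ η[A.X] ≫ CocModComon.proj p := by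
  have h1 := ((isPsi_iff p i).1 h).w
  have h2 : (Δ[A.X] ≫ CocModComon.proj p ▷ A.X) ≫ Q.X ◁ ε[A.X] =
      CocModComon.proj p ≫ (ρ_ Q.X).inv := by
    rw [Category.assoc, ← whisker_exchange, ComonObj.comul_counit_assoc,
      rightUnitor_inv_naturality]
  have h3 : ((λ_ A.X).inv ≫ (η[A.X] ≫ CocModComon.proj p) ▷ A.X) ≫ Q.X ◁ ε[A.X] =
      ε[A.X] ≫ η[A.X] ≫ CocModComon.proj p ≫ (ρ_ Q.X).inv := by
    rw [Category.assoc, ← whisker_exchange, ← leftUnitor_inv_naturality_assoc, unitors_inv_equal,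
      ← rightUnitor_inv_naturality, Category.assoc]
  rw [← cancel_mono (ρ_ Q.X).inv]
  simp only [Category.assoc]
  rw [← h2, ← Category.assoc, h1, Category.assoc, h3, h2, IsComonHom.hom_counit_assoc]

/-- Tested on comonoid morphisms, `ψ(p)` is the fibre of `p` over `p(1)`: `p(x(d)₁) ⊗ x(d)₂ =
p(x(d₁)) ⊗ x(d₂)`, where the first factor is constant by hypothesis. -/
theorem pair_psi {D : C} [ComonObj D] (p : CocModComon.regular A ⟶ Q) (x : D ⟶ A.X)
    [IsComonHom x] (hx : x ≫ CocModComon.proj p = ε[D] ≫ η[A.X] ≫ CocModComon.proj p) :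
    x ≫ Δ[A.X] ≫ CocModComon.proj p ▷ A.X =
      x ≫ (λ_ A.X).inv ≫ (η[A.X] ≫ CocModComon.proj p) ▷ A.X := by
  have h1 : x ≫ Δ[A.X] = pair x x := IsComonHom.hom_comul x
  rw [reassoc_of% h1, pair_whiskerRight, hx, pair_counit_left]

theorem IsPsi.exists_lift {p : CocModComon.regular A ⟶ Q} {i : K ⟶ A} (h : IsPsi p i) {D : C}
    [ComonObj D] (x : D ⟶ A.X) [IsComonHom x]
    (hx : x ≫ CocModComon.proj p = ε[D] ≫ η[A.X] ≫ CocModComon.proj p) :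
    ∃ s : D ⟶ K.X, s ≫ i.hom = x :=
  ((isPsi_iff p i).1 h).lift x (pair_psi p x hx)

/-- Put `a = 1` in `p(a k) = p(a) ε(k)` for one direction; use `p(a k) = a · p(k)` for the other. -/
theorem comp_proj_iff {p : CocModComon.regular A ⟶ Q} {i : K ⟶ A} :
    (A.X ◁ i.hom ≫ μ[A.X]) ≫ CocModComon.proj p = fst A.X K.X ≫ CocModComon.proj p ↔
      i.hom ≫ CocModComon.proj p = ε[K.X] ≫ η[A.X] ≫ CocModComon.proj p := by
  constructor
  · intro h
    have h2 := congr((λ_ K.X).inv ≫ η[A.X] ▷ K.X ≫ $h)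
    rw [fst] at h2
    simp only [Category.assoc] at h2
    rw [← whisker_exchange_assoc, ← whisker_exchange_assoc, MonObj.one_mul_assoc,
      leftUnitor_naturality_assoc, Iso.inv_hom_id_assoc, rightUnitor_naturality_assoc,
      ← leftUnitor_inv_naturality_assoc, ← unitors_equal, Iso.inv_hom_id_assoc] at h2
    exact h2
  · intro h
    rw [Category.assoc, mul_proj, ← whiskerLeft_comp_assoc, h, whiskerLeft_comp_assoc,
      whiskerLeft_comp_assoc, ← mul_proj, MonObj.mul_one_assoc, fst, Category.assoc]

theorem IsPhi.comp_proj {p : CocModComon.regular A ⟶ Q} {i : K ⟶ A} (h : IsPhi i p) :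
    i.hom ≫ CocModComon.proj p = ε[K.X] ≫ η[A.X] ≫ CocModComon.proj p :=
  comp_proj_iff.1 ((isPhi_iff i p).1 h).w

/-- `ψ(φ(ψ(p))) = ψ(p)`. -/
theorem IsPsi.of_isPhi {p : CocModComon.regular A ⟶ Q} {p' : CocModComon.regular A ⟶ Q'}
    {i : K ⟶ A} (h' : IsPsi p' i) (h : IsPhi i p) : IsPsi p i := by
  -- Since `p'` factors through `p`, every morphism equalized by the pair for `p` is equalized by
  -- the pair for `p'`.
  obtain ⟨t, ht⟩ := ((isPhi_iff i p).1 h).desc (CocModComon.proj p')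
    (comp_proj_iff.2 h'.comp_proj)
  refine (isPsi_iff p i).2 ⟨((isPsi_iff p' i).1 h').mono, pair_psi p i.hom h.comp_proj,
    fun x hx => ((isPsi_iff p' i).1 h').lift x ?_⟩
  have := congr($hx ≫ t ▷ A.X)
  simpa only [Category.assoc, ← comp_whiskerRight, ht] using this

theorem IsPsi.congr_iso {p : CocModComon.regular A ⟶ Q} {p' : CocModComon.regular A ⟶ Q'}
    {i : K ⟶ A} (h : IsPsi p i) (e : Q.X ≅ Q'.X)
    (he : CocModComon.proj p ≫ e.hom = CocModComon.proj p') : IsPsi p' i := by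
  refine (isPsi_iff p' i).2 (((isPsi_iff p i).1 h).congr fun x => ?_)
  rw [← he, ← cancel_mono (e.hom ▷ A.X)]
  simp

/-! ### Kernels of morphisms of cocommutative Hopf monoids -/

/-- A morphism `f : A ⟶ B` of cocommutative Hopf monoids turns `B` into a comonoid in left
`A`-modules. -/
def CocModComon.ofHom {A B : CocHopf C} (f : A ⟶ B) : CocModComon A :=
  letI : ModObj A.X B.X :=
    { smul := f.hom ▷ B.X ≫ μ[B.X]
      one_smul := by
        change η[A.X] ▷ B.X ≫ f.hom ▷ B.X ≫ μ[B.X] = (λ_ B.X).hom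
        rw [← comp_whiskerRight_assoc, IsMonHom.one_hom, MonObj.one_mul]
      mul_smul := by
        change μ[A.X] ▷ B.X ≫ f.hom ▷ B.X ≫ μ[B.X] =
          (α_ _ _ _).hom ≫ A.X ◁ (f.hom ▷ B.X ≫ μ[B.X]) ≫ f.hom ▷ B.X ≫ μ[B.X]
        rw [← comp_whiskerRight_assoc, IsMonHom.mul_hom, comp_whiskerRight_assoc,
          MonObj.mul_assoc, tensorHom_def']
        simp only [comp_whiskerRight, Category.assoc, whiskerLeft_comp]
        rw [associator_naturality_left_assoc, ← whisker_exchange_assoc, whisker_exchange_assoc]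
        simp }
  { X := B.X
    comul_linear := by
      change (f.hom ▷ B.X ≫ μ[B.X]) ≫ Δ[B.X] = A.X ◁ Δ[B.X] ≫ Δ[A.X] ▷ (B.X ⊗ B.X) ≫
        tensorμ A.X A.X B.X B.X ≫ ((f.hom ▷ B.X ≫ μ[B.X]) ⊗ₘ (f.hom ▷ B.X ≫ μ[B.X]))
      rw [← tensorHom_comp_tensorHom, ← tensorμ_natural_left_assoc, ← comp_whiskerRight_assoc,
        ← IsComonHom.hom_comul, comp_whiskerRight_assoc, whisker_exchange_assoc,
        whisker_exchange_assoc, Category.assoc, BimonObj.mul_comul, tensorHom_def'_assoc,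
        whisker_exchange_assoc]
    counit_linear := by
      change (f.hom ▷ B.X ≫ μ[B.X]) ≫ ε[B.X] = _
      rw [Category.assoc, Bimon.mul_counit, MonoidalCategory.tensorHom_def, Category.assoc,
        ← comp_whiskerRight_assoc, IsComonHom.hom_counit, whisker_exchange_assoc] }

/-- A morphism of cocommutative Hopf monoids as a morphism of comonoids in left modules. -/
def CocModComon.homOfHom {A B : CocHopf C} (f : A ⟶ B) :
    CocModComon.regular A ⟶ CocModComon.ofHom f where
  hom := f.hom
  isComonHom := inferInstanceAs (IsComonHom f.hom)
  linear := by
    change μ[A.X] ≫ f.hom = A.X ◁ f.hom ≫ f.hom ▷ B.X ≫ μ[B.X]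
    rw [IsMonHom.mul_hom, tensorHom_def', Category.assoc]

theorem comp_proj_homOfHom_iff {A B : CocHopf C} (f : A ⟶ B) {D : C} [ComonObj D] (x : D ⟶ A.X) :
    x ≫ CocModComon.proj (CocModComon.homOfHom f) =
      ε[D] ≫ η[A.X] ≫ CocModComon.proj (CocModComon.homOfHom f) ↔
    x ≫ f.hom = ε[D] ≫ η[B.X] := by
  change x ≫ f.hom = ε[D] ≫ η[A.X] ≫ f.hom ↔ _
  rw [IsMonHom.one_hom]

end

section

variable {A B K : CocHopf C}

/-- A morphism of Hopf monoids into `A` factors through a Hopf monomorphism if it does so in `C`. -/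
theorem CocHopf.exists_hom_lift {D : CocHopf C} {i : K ⟶ A} [Mono i.hom] [Mono (i.hom ⊗ₘ i.hom)]
    (x : D ⟶ A) (s : D.X ⟶ K.X) (hs : s ≫ i.hom = x.hom) : ∃ t : D ⟶ K, t ≫ i = x := by
  have : IsBimonHom s :=
    { one_hom := by rw [← cancel_mono i.hom, Category.assoc, hs, IsMonHom.one_hom,
        IsMonHom.one_hom]
      mul_hom := by rw [← cancel_mono i.hom, Category.assoc, hs, Category.assoc, IsMonHom.mul_hom,
        IsMonHom.mul_hom, tensorHom_comp_tensorHom_assoc, hs]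
      hom_counit := by rw [← IsComonHom.hom_counit i.hom, reassoc_of% hs, IsComonHom.hom_counit]
      hom_comul := by rw [← cancel_mono (i.hom ⊗ₘ i.hom), Category.assoc, ← IsComonHom.hom_comul,
        reassoc_of% hs, IsComonHom.hom_comul, Category.assoc, tensorHom_comp_tensorHom, hs] }
  exact ⟨⟨s⟩, CocHopf.hom_ext hs⟩

/-- A morphism of Hopf monoids out of `A` descends along a Hopf epimorphism if it does so in `C`. -/
theorem CocHopf.exists_hom_desc {D : CocHopf C} {p : A ⟶ K} [Epi p.hom] [Epi (p.hom ⊗ₘ p.hom)]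
    (x : A ⟶ D) (s : K.X ⟶ D.X) (hs : p.hom ≫ s = x.hom) : ∃ t : K ⟶ D, t.hom = s := by
  have : IsBimonHom s :=
    { one_hom := by rw [← IsMonHom.one_hom p.hom, Category.assoc, hs, IsMonHom.one_hom]
      mul_hom := by rw [← cancel_epi (p.hom ⊗ₘ p.hom), ← IsMonHom.mul_hom_assoc, hs,
        IsMonHom.mul_hom, tensorHom_comp_tensorHom_assoc, hs]
      hom_counit := by rw [← cancel_epi p.hom, reassoc_of% hs, IsComonHom.hom_counit,
        IsComonHom.hom_counit]
      hom_comul := by rw [← cancel_epi p.hom, reassoc_of% hs, IsComonHom.hom_comul,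
        IsComonHom.hom_comul_assoc, tensorHom_comp_tensorHom, hs] }
  exact ⟨⟨s⟩, rfl⟩

variable [∀ X : C, PreservesLimitsOfShape WalkingParallelPair (tensorLeft X)]
  [∀ X : C, PreservesLimitsOfShape WalkingParallelPair (tensorRight X)]

/-- A Hopf morphism `x` is a comonoid morphism, so `x ≫ f = 0` already suffices to lift `x` through
the equalizer `i` in `C`; the lift is a Hopf morphism because `i` and `i ⊗ i` are monic in `C`. -/
theorem isKernelHom_of_isPsi {f : A ⟶ B} {i : K ⟶ A} (h : IsPsi (CocModComon.homOfHom f) i) :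
    CocHopf.IsKernelHom i := by
  have he := (isPsi_iff _ i).1 h
  have := he.mono
  have := he.mono_tensorHom
  have hi : Mono i := ⟨fun a b hab => CocHopf.hom_ext ((cancel_mono i.hom).1 congr(($hab).hom))⟩
  refine ⟨⟨B, f, ?_, ?_⟩⟩
  · ext
    exact (comp_proj_homOfHom_iff f i.hom).1 h.comp_proj
  · refine KernelFork.IsLimit.ofι' i _ fun {D} x hx => ?_
    have h1 : ∃ t : D ⟶ K, t ≫ i = x := by
      obtain ⟨s, hs⟩ := h.exists_lift x.hom ((comp_proj_homOfHom_iff f x.hom).2 congr(($hx).hom))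
      exact CocHopf.exists_hom_lift x s hs
    exact ⟨h1.choose, h1.choose_spec⟩

/-- The given kernel is compared with the constructed `ψ(f)`. Each factors through the other in the
Hopf category, so the given kernel is also an equalizer in `C`. -/
theorem exists_isPsi_of_isKernelHom [HasEqualizers C] {i : K ⟶ A} (h : CocHopf.IsKernelHom i) :
    ∃ (B : CocHopf C) (f : A ⟶ B), IsPsi (CocModComon.homOfHom f) i := by
  obtain ⟨⟨B, f, w, l⟩⟩ := h
  refine ⟨B, f, ?_⟩
  obtain ⟨K', i', h'⟩ := exists_isPsi (CocModComon.homOfHom f)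
  have he := (isPsi_iff _ i').1 h'
  have := he.mono
  have := he.mono_tensorHom
  have w' : i' ≫ f = 0 := by
    ext
    exact (comp_proj_homOfHom_iff f i'.hom).1 h'.comp_proj
  obtain ⟨s, hs⟩ : ∃ s : K' ⟶ K, s ≫ i = i' := ⟨_, (KernelFork.IsLimit.lift' l i' w').2⟩
  obtain ⟨t, ht⟩ : ∃ t : K ⟶ K', t ≫ i' = i := by
    obtain ⟨s, hs⟩ := h'.exists_lift i.hom ((comp_proj_homOfHom_iff f i.hom).2 congr(($w).hom))
    exact CocHopf.exists_hom_lift i s hs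
  have hi : Mono i := ⟨fun a b hab => Fork.IsLimit.hom_ext l hab⟩
  have hts : t ≫ s = 𝟙 K := by rw [← cancel_mono i, Category.assoc, hs, ht, Category.id_comp]
  have hst : s.hom ≫ t.hom = 𝟙 K'.X := by
    rw [← cancel_mono i'.hom, Category.assoc, ← CocHopf.comp_hom, ht, ← CocHopf.comp_hom, hs,
      Category.id_comp]
  refine (isPsi_iff _ i).2 ?_
  have := he.iso_comp ⟨t.hom, s.hom, congr(($hts).hom), hst⟩
  rw [← ht]
  exact this

end

end NewmanHopf
end

noncomputable section

namespace NewmanHopf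

variable {C : Type u} [Category.{v} C] [MonoidalCategory C] [BraidedCategory C]

attribute [local instance] ModObj.regular

/-! ### Quotients by normal Hopf submonoids -/

section Normal

variable {A B K : CocHopf C} {Q : CocModComon A}

/-- If `K` is the kernel of a morphism of Hopf monoids, then `A K⁺` is also a right ideal:
`p (k a) = ε(k) p(a)`. -/
theorem mul_proj_of_isPsi_homOfHom [PreservesLimitsOfShape WalkingParallelPair (tensorLeft A.X)]
    {f : A ⟶ B} {i : K ⟶ A} (h : IsPsi (CocModComon.homOfHom f) i)
    {p : CocModComon.regular A ⟶ Q} (hp : IsPhi i p) :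
    (i.hom ▷ A.X ≫ μ[A.X]) ≫ CocModComon.proj p = snd K.X A.X ≫ CocModComon.proj p := by
  have hms : (i.hom ▷ A.X ≫ μ[A.X]) ≫ f.hom = snd K.X A.X ≫ f.hom := by
    have hif := (comp_proj_homOfHom_iff f i.hom).1 h.comp_proj
    rw [Category.assoc, IsMonHom.mul_hom, MonoidalCategory.tensorHom_def, Category.assoc,
      ← comp_whiskerRight_assoc, hif, comp_whiskerRight_assoc, ← whisker_exchange_assoc,
      MonObj.one_mul, leftUnitor_naturality, snd, Category.assoc]
  set m := i.hom ▷ A.X ≫ μ[A.X] with hm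
  have : IsComonHom m := inferInstanceAs (IsComonHom (i.hom ▷ A.X ≫ μ[A.X]))
  have hs : snd K.X A.X ≫ Δ[A.X] = pair (snd K.X A.X) (snd K.X A.X) := IsComonHom.hom_comul _
  have hm' : m ≫ Δ[A.X] = pair m m := IsComonHom.hom_comul _
  -- As `f(k a) = ε(k) f(a)`, the element `k a₁ ⊗ a₂` lies in `A □_B A`, hence is the shear of some
  -- `y` in `A ⊗ K`. The two counits express `k a` and `ε(k) a` as the images of `y` under the two
  -- maps that `p` coequalizes.
  obtain ⟨y, hy⟩ := (isEqualizerOf_cotensor h).lift (pair m (snd K.X A.X)) (by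
    change pair m _ ≫ (Δ[A.X] ≫ A.X ◁ f.hom) ▷ A.X ≫ (α_ A.X B.X A.X).hom =
      pair m _ ≫ A.X ◁ (Δ[A.X] ≫ f.hom ▷ A.X)
    rw [reassoc_of% @pair_whiskerRight, reassoc_of% hm', pair_whiskerLeft, pair_assoc, pair_whiskerLeft,
      reassoc_of% hs, pair_whiskerRight, hms])
  have h1 : m = y ≫ fst A.X K.X := by
    rw [← shear_counit_right i, reassoc_of% hy, reassoc_of% @pair_whiskerLeft, IsComonHom.hom_counit,
      reassoc_of% @pair_counit_right_hom, Iso.inv_hom_id, Category.comp_id]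
  have h2 : snd K.X A.X = y ≫ A.X ◁ i.hom ≫ μ[A.X] := by
    rw [← shear_counit_left A, reassoc_of% hy, reassoc_of% @pair_whiskerRight, IsComonHom.hom_counit,
      reassoc_of% @pair_counit_left_hom, Iso.inv_hom_id, Category.comp_id]
  have h3 := ((isPhi_iff i p).1 hp).w
  rw [h1, h2, Category.assoc, ← h3]
  simp only [Category.assoc]

variable [∀ X : C, PreservesColimitsOfShape WalkingParallelPair (tensorLeft X)]
  [∀ X : C, PreservesColimitsOfShape WalkingParallelPair (tensorRight X)]

/-- If `A K⁺` is a two-sided ideal, then `φ(i)` is a morphism of Hopf monoids. -/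
theorem exists_hopf_of_isPhi {i : K ⟶ A} {p : CocModComon.regular A ⟶ Q} (hp : IsPhi i p)
    (hn : (i.hom ▷ A.X ≫ μ[A.X]) ≫ CocModComon.proj p = snd K.X A.X ≫ CocModComon.proj p) :
    ∃ (H : CocHopf C) (π : A ⟶ H) (e : H.X ≅ Q.X), IsComonHom e.hom ∧
      π.hom ≫ e.hom = CocModComon.proj p := by
  have h := (isPhi_iff i p).1 hp
  have := (h.whiskerLeft (A.X ⊗ K.X)).epi
  -- The action `A ⊗ Q ⟶ Q` descends in its first variable, since `p(a k b) = ε(k) p(a b)` by `hn`.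
  obtain ⟨mul, h_mul⟩ := (h.whiskerRight Q.X).desc γ[A.X, Q.X] (by
    rw [← cancel_epi ((A.X ⊗ K.X) ◁ CocModComon.proj p), whisker_exchange_assoc,
      whisker_exchange_assoc, ← mul_proj]
    have h1 : (A.X ◁ i.hom ≫ μ[A.X]) ▷ A.X ≫ μ[A.X] =
        (α_ _ _ _).hom ≫ A.X ◁ (i.hom ▷ A.X ≫ μ[A.X]) ≫ μ[A.X] := by simp
    have h2 : fst A.X K.X ▷ A.X = (α_ _ _ _).hom ≫ A.X ◁ snd K.X A.X := by simp [fst, snd]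
    rw [reassoc_of% h1, h2, Category.assoc, mul_proj, ← whiskerLeft_comp_assoc,
      ← whiskerLeft_comp_assoc, hn])
  -- The antipode reverses products and so moves `K` to the left of `A`, where `hn` applies.
  obtain ⟨antipode, h_antipode⟩ := h.desc (𝒮[A.X] ≫ CocModComon.proj p) (by
    have h1 : (A.X ◁ i.hom ≫ μ[A.X]) ≫ 𝒮[A.X] =
        (𝒮[A.X] ⊗ₘ 𝒮[K.X]) ≫ (β_ _ _).hom ≫ i.hom ▷ A.X ≫ μ[A.X] := by
      rw [← BraidedCategory.braiding_naturality_right_assoc, Category.assoc, HopfObj.mul_antipode,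
        ← id_tensorHom, tensorHom_comp_tensorHom_assoc, tensorHom_comp_tensorHom_assoc,
        HopfObj.hom_antipode i.hom, Category.id_comp, Category.comp_id]
    have h2 : fst A.X K.X ≫ 𝒮[A.X] =
        (𝒮[A.X] ⊗ₘ 𝒮[K.X]) ≫ (β_ _ _).hom ≫ snd K.X A.X := by
      rw [snd, ← BraidedCategory.braiding_naturality_right_assoc, fst, braiding_leftUnitor,
        ← id_tensorHom, tensorHom_comp_tensorHom_assoc, HopfObj.antipode_counit, Category.comp_id,
        Category.assoc, ← rightUnitor_naturality, ← tensorHom_id, tensorHom_comp_tensorHom_assoc,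
        Category.id_comp, Category.comp_id]
    rw [← Category.assoc, h1, reassoc_of% h2, ← hn]
    simp only [Category.assoc])
  let S : HopfQuot A :=
    { X := Q.X
      π := CocModComon.proj p
      epi := h.epi
      epi_whiskerLeft := fun W => (h.whiskerLeft W).epi
      epi_whiskerRight := fun W => (h.whiskerRight W).epi
      epi_whisker := fun V W => ((h.whiskerLeft V).whiskerRight W).epi
      mul := mul
      π_mul := by rw [tensorHom_def', Category.assoc, h_mul, mul_proj]
      antipode := antipode
      π_antipode := h_antipode }
  exact ⟨S.toCocHopf, S.projHom, Iso.refl _, inferInstanceAs (IsComonHom (𝟙 Q.X)),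
    Category.comp_id _⟩

/-- A Hopf morphism `π` with underlying morphism `φ(i)` is a cokernel of `i`. -/
theorem isRegularEpi_of_isCoequalizerOf {H : CocHopf C} {i : K ⟶ A} {π : A ⟶ H}
    (h : IsCoequalizerOf (A.X ◁ i.hom ≫ μ[A.X]) (fst A.X K.X) π.hom) : IsRegularEpi π := by
  have := h.epi
  have := h.epi_tensorHom
  have hπ : Epi π := ⟨fun a b hab => CocHopf.hom_ext ((cancel_epi π.hom).1 congr(($hab).hom))⟩
  -- For Hopf morphisms, killing `i` is the same as coequalizing the pair in `C`; hence `π` is the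
  -- coequalizer of `i` and `0`.
  have hcomp {D : CocHopf C} (t : A ⟶ D) : i ≫ t = 0 ↔
      (A.X ◁ i.hom ≫ μ[A.X]) ≫ t.hom = fst A.X K.X ≫ t.hom := by
    refine Iff.trans ?_ (comp_proj_iff (p := CocModComon.homOfHom t)).symm
    rw [comp_proj_homOfHom_iff]
    exact CocHopf.hom_ext_iff
  have hz : i ≫ π = (0 : K ⟶ A) ≫ π := by rw [zero_comp, hcomp, h.w]
  refine ⟨⟨⟨K, i, 0, hz, ?_⟩⟩⟩
  have hdesc (s : Cofork i 0) : ∃ t : H ⟶ s.pt, π ≫ t = s.π := by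
    obtain ⟨t, ht⟩ := h.desc s.π.hom ((hcomp s.π).1 (by rw [s.condition, zero_comp]))
    obtain ⟨t', rfl⟩ := CocHopf.exists_hom_desc s.π t ht
    exact ⟨t', CocHopf.hom_ext ht⟩
  exact Cofork.IsColimit.mk _ (fun s => (hdesc s).choose) (fun s => (hdesc s).choose_spec)
    fun s m hm => by
      rw [← cancel_epi π]
      exact hm.trans (hdesc s).choose_spec.symm

/-- A regular epimorphism `f` of cocommutative Hopf monoids is `φ` of its kernel. -/
theorem isCoequalizerOf_of_isRegularEpi [HasCoequalizers C]
    [PreservesLimitsOfShape WalkingParallelPair (tensorLeft A.X)]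
    {f : A ⟶ B} (hf : IsRegularEpi f) {i : K ⟶ A} (h : IsPsi (CocModComon.homOfHom f) i) :
    IsCoequalizerOf (A.X ◁ i.hom ≫ μ[A.X]) (fst A.X K.X) f.hom := by
  obtain ⟨Q, p, hp⟩ := exists_isPhi i
  obtain ⟨H, π, e, -, hπe⟩ := exists_hopf_of_isPhi hp (mul_proj_of_isPsi_homOfHom h hp)
  have hπ : IsCoequalizerOf (A.X ◁ i.hom ≫ μ[A.X]) (fst A.X K.X) π.hom := by
    have := ((isPhi_iff i p).1 hp).comp_iso e.symm
    rwa [← hπe, Iso.symm_hom, Category.assoc, Iso.hom_inv_id, Category.comp_id] at this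
  obtain ⟨⟨W, l, r, w, hc⟩⟩ := hf
  have hlr : l ≫ π = r ≫ π := by
    ext
    have hk : IsComonHom (conv (r.hom ≫ 𝒮[A.X]) l.hom) := inferInstance
    -- The convolution `r⁻¹ l` is a comonoid morphism that `f` trivializes, so it factors through
    -- `K`. Thus `l` is `r` times an element of `K`, and `π` does not see that factor.
    obtain ⟨s, hs⟩ := h.exists_lift (conv (r.hom ≫ 𝒮[A.X]) l.hom) (by
      rw [comp_proj_homOfHom_iff, conv_comp, Category.assoc, ← HopfObj.hom_antipode,
        ← Category.assoc, ← CocHopf.comp_hom, ← CocHopf.comp_hom, w, antipode_conv])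
    have hl : l.hom = conv r.hom (s ≫ i.hom) := by
      rw [hs, ← conv_assoc, conv_antipode, one_conv]
    have hsε : s ≫ ε[K.X] = ε[W.X] := by
      rw [← IsComonHom.hom_counit i.hom, reassoc_of% hs, IsComonHom.hom_counit]
    rw [CocHopf.comp_hom, CocHopf.comp_hom, hl, conv, ← pair_whiskerLeft, Category.assoc,
      Category.assoc]
    have hw := hπ.w
    rw [Category.assoc] at hw
    rw [hw, fst, Category.assoc, reassoc_of% @pair_whiskerLeft, hsε, reassoc_of% @pair_counit_right_hom,
      Iso.inv_hom_id_assoc]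
  obtain ⟨t, ht⟩ : ∃ t : B ⟶ H, f ≫ t = π := ⟨_, Cofork.IsColimit.π_desc' hc π hlr⟩
  have := hπ.epi
  have := hπ.epi_tensorHom
  have hfK : (A.X ◁ i.hom ≫ μ[A.X]) ≫ f.hom = fst A.X K.X ≫ f.hom :=
    comp_proj_iff (p := CocModComon.homOfHom f) |>.2 h.comp_proj
  -- Conversely `f` factors through `π`, so `f` and `π = φ(i)` agree up to isomorphism.
  obtain ⟨t', ht'⟩ := hπ.desc f.hom hfK
  obtain ⟨t', rfl⟩ := CocHopf.exists_hom_desc f t' ht'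
  have hf : Epi f := ⟨fun a b hab => Cofork.IsColimit.hom_ext hc hab⟩
  have h1 : t ≫ t' = 𝟙 B := by
    rw [← cancel_epi f, reassoc_of% ht, Category.comp_id]
    exact CocHopf.hom_ext ht'
  have h2 : t'.hom ≫ t.hom = 𝟙 H.X := by
    rw [← cancel_epi π.hom, reassoc_of% ht', ← CocHopf.comp_hom, ht, Category.comp_id]
  rw [← ht']
  exact hπ.comp_iso ⟨t'.hom, t.hom, h2, congr(($h1).hom)⟩

end Normal

end NewmanHopf
end

noncomputable section

namespace NewmanHopf

variable {C : Type u} [Category.{v} C] [MonoidalCategory C] [BraidedCategory C]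

/-! ### Subobjects and quotients -/

section

variable {A K K' : CocHopf C} {Q Q' : CocModComon A}

theorem IsPsi.mono {p : CocModComon.regular A ⟶ Q} {i : K ⟶ A} (h : IsPsi p i) : Mono i :=
  have := ((isPsi_iff p i).1 h).mono
  ⟨fun _ _ hab => CocHopf.hom_ext ((cancel_mono i.hom).1 congr(($hab).hom))⟩

theorem IsPhi.epi {i : K ⟶ A} {p : CocModComon.regular A ⟶ Q} (h : IsPhi i p) : Epi p :=
  have := ((isPhi_iff i p).1 h).epi
  ⟨fun _ _ hab =>
    CocModComon.hom_ext ((cancel_epi (CocModComon.proj p)).1 congr(($hab).hom))⟩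

theorem IsPsi.iso_comp {p : CocModComon.regular A ⟶ Q} {i : K ⟶ A} (h : IsPsi p i) (e : K' ≅ K) :
    IsPsi p (e.hom ≫ i) :=
  (isPsi_iff p _).2 (((isPsi_iff p i).1 h).iso_comp
    ⟨e.hom.hom, e.inv.hom, congr(($(e.hom_inv_id)).hom), congr(($(e.inv_hom_id)).hom)⟩)

theorem IsPhi.comp_iso {i : K ⟶ A} {p : CocModComon.regular A ⟶ Q} (h : IsPhi i p) (e : Q ≅ Q') :
    IsPhi i (p ≫ e.hom) :=
  (isPhi_iff i _).2 (((isPhi_iff i p).1 h).comp_iso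
    ⟨e.hom.hom, e.inv.hom, congr(($(e.hom_inv_id)).hom), congr(($(e.inv_hom_id)).hom)⟩)

theorem IsPsi.mk {p : CocModComon.regular A ⟶ Q} {i : K ⟶ A} [Mono i] (h : IsPsi p i) :
    IsPsi p (Subobject.mk i).arrow := by
  rw [← Subobject.underlyingIso_hom_comp_eq_mk]
  exact h.iso_comp _

theorem IsPhi.mk {i : K ⟶ A} {p : CocModComon.regular A ⟶ Q} [Epi p] (h : IsPhi i p) :
    IsPhi i (ModComonQuotient.π (Subobject.mk p.op)) := by
  rw [ModComonQuotient.π, ← Subobject.underlyingIso_hom_comp_eq_mk]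
  exact h.comp_iso (Subobject.underlyingIso p.op).unop

theorem HopfSubobject.eq_of_isPsi [∀ X : C, PreservesLimitsOfShape WalkingParallelPair (tensorLeft X)]
    [∀ X : C, PreservesLimitsOfShape WalkingParallelPair (tensorRight X)]
    {p : CocModComon.regular A ⟶ Q} {S S' : HopfSubobject A} (h : IsPsi p S.arrow)
    (h' : IsPsi p S'.arrow) : S = S' := by
  have key {S S' : HopfSubobject A} (h : IsPsi p S.arrow) (h' : IsPsi p S'.arrow) : S ≤ S' := by
    have he := (isPsi_iff p _).1 h
    have he' := (isPsi_iff p _).1 h'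
    have := he'.mono
    have := he'.mono_tensorHom
    obtain ⟨s, hs⟩ := he'.lift _ he.w
    obtain ⟨t, ht⟩ := CocHopf.exists_hom_lift _ s hs
    exact Subobject.le_of_comm t ht
  exact le_antisymm (key h h') (key h' h)

theorem ModComonQuotient.eq_of_isPhi
    [∀ X : C, PreservesColimitsOfShape WalkingParallelPair (tensorLeft X)]
    {i : K ⟶ A} {Q Q' : ModComonQuotient A} (h : IsPhi i Q.π) (h' : IsPhi i Q'.π) : Q = Q' := by
  -- Quotients are subobjects in the opposite category, so a morphism `Q ⟶ Q'` under `A` yields `Q'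
  -- ≤ Q`.
  have key {Q Q' : ModComonQuotient A} (h : IsPhi i Q.π) (h' : IsPhi i Q'.π) : Q' ≤ Q := by
    have he := (isPhi_iff i _).1 h
    have he' := (isPhi_iff i _).1 h'
    have := he.epi
    have := (he.whiskerLeft A.X).epi
    obtain ⟨s, hs⟩ := he.desc _ he'.w
    have hs' : IsComonHom s :=
      { hom_counit := by
          rw [← cancel_epi (CocModComon.proj Q.π), reassoc_of% hs, IsComonHom.hom_counit,
            IsComonHom.hom_counit]
        hom_comul := by
          rw [← cancel_epi (CocModComon.proj Q.π), reassoc_of% hs, IsComonHom.hom_comul,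
            IsComonHom.hom_comul_assoc, tensorHom_comp_tensorHom, hs] }
    let t : (Subobject.underlying.obj Q).unop ⟶ (Subobject.underlying.obj Q').unop :=
      { hom := s
        linear := by
          rw [← cancel_epi (A.X ◁ CocModComon.proj Q.π)]
          change _ ≫ γ[A.X, _] ≫ s = _ ≫ _ ≫ γ[A.X, _]
          rw [← reassoc_of% @mul_proj, hs, ← whiskerLeft_comp_assoc, hs, mul_proj] }
    have ht : Q.π ≫ t = Q'.π := CocModComon.hom_ext hs
    exact Subobject.le_of_comm t.op congr(($ht).op)
  exact le_antisymm (key h' h) (key h h')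

end

/-! ### Kernels, regular epimorphisms and the Newman bijection. -/

section

variable {A K : CocHopf C} {Q : CocModComon A}
variable [HasEqualizers C] [HasCoequalizers C]
    [∀ X : C, PreservesLimitsOfShape WalkingParallelPair (tensorLeft X)]
    [∀ X : C, PreservesLimitsOfShape WalkingParallelPair (tensorRight X)]
    [∀ X : C, PreservesColimitsOfShape WalkingParallelPair (tensorLeft X)]
    [∀ X : C, PreservesColimitsOfShape WalkingParallelPair (tensorRight X)]

theorem isBalancedEqualizer_of_isKernelHom {i : K ⟶ A} (h : CocHopf.IsKernelHom i) :
    IsBalancedEqualizer i := by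
  obtain ⟨B, f, hf⟩ := exists_isPsi_of_isKernelHom h
  obtain ⟨Q, p, hp⟩ := exists_isPhi i
  exact (isBalancedEqualizer_iff hp).2 (hf.of_isPhi hp)

/-- Up to isomorphism `p` is a regular epimorphism `f`, which is `φ` of its kernel `ψ(f)`; so `p =
φ(ψ(p))`. -/
theorem isCotensorCoequalizer_of_isRegularEpiOfHopf {p : CocModComon.regular A ⟶ Q}
    (h : CocModComon.IsRegularEpiOfHopf p) : IsCotensorCoequalizer p := by
  obtain ⟨H, f, e, -, he, hf⟩ := h
  obtain ⟨K, i, hi⟩ := exists_isPsi (CocModComon.homOfHom f)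
  refine (isCotensorCoequalizer_iff (hi.congr_iso e he)).2 ((isPhi_iff i p).2 ?_)
  rw [← he]
  exact (isCoequalizerOf_of_isRegularEpi hf hi).comp_iso e

theorem isKernelHom_iff_isRegularEpiOfHopf {i : K ⟶ A} {p : CocModComon.regular A ⟶ Q}
    (hi : IsBalancedEqualizer i) (hp : IsPhi i p) :
    CocHopf.IsKernelHom i ↔ CocModComon.IsRegularEpiOfHopf p := by
  constructor
  · intro h
    obtain ⟨B, f, hf⟩ := exists_isPsi_of_isKernelHom h
    obtain ⟨H, π, e, he, hπ⟩ := exists_hopf_of_isPhi hp (mul_proj_of_isPsi_homOfHom hf hp)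
    refine ⟨H, π, e, he, hπ, isRegularEpi_of_isCoequalizerOf (i := i) ?_⟩
    have := ((isPhi_iff i p).1 hp).comp_iso e.symm
    rwa [← hπ, Iso.symm_hom, Category.assoc, Iso.hom_inv_id, Category.comp_id] at this
  · rintro ⟨H, f, e, -, he, -⟩
    have h := (isBalancedEqualizer_iff hp).1 hi
    have hf : CocModComon.proj p ≫ e.inv = f.hom := by
      rw [← he, Category.assoc, Iso.hom_inv_id, Category.comp_id]
    exact isKernelHom_of_isPsi (h.congr_iso (Q' := CocModComon.ofHom f) e.symm hf)

end

end NewmanHopf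
end

theorem corollary6p10 {C : Type u} [Category.{v} C] [MonoidalCategory C] [BraidedCategory C]
    [HasEqualizers C] [HasCoequalizers C]
    [∀ X : C, PreservesLimitsOfShape WalkingParallelPair (tensorLeft X)]
    [∀ X : C, PreservesLimitsOfShape WalkingParallelPair (tensorRight X)]
    [∀ X : C, PreservesColimitsOfShape WalkingParallelPair (tensorLeft X)]
    [∀ X : C, PreservesColimitsOfShape WalkingParallelPair (tensorRight X)]
    (A : NewmanHopf.CocHopf C) :
    ∃ e : {S : NewmanHopf.HopfSubobject A // NewmanHopf.IsBalancedEqualizer S.arrow} ≃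
        {Q : NewmanHopf.ModComonQuotient A // NewmanHopf.IsCotensorCoequalizer Q.π},
      (∀ S, NewmanHopf.IsPhi S.1.arrow (e S).1.π) ∧
      (∀ Q, NewmanHopf.IsPsi Q.1.π (e.symm Q).1.arrow) ∧
      (∀ S : NewmanHopf.HopfSubobject A, NewmanHopf.CocHopf.IsKernelHom S.arrow →
        NewmanHopf.IsBalancedEqualizer S.arrow) ∧
      (∀ Q : NewmanHopf.ModComonQuotient A, NewmanHopf.CocModComon.IsRegularEpiOfHopf Q.π →
        NewmanHopf.IsCotensorCoequalizer Q.π) ∧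
      (∀ S, NewmanHopf.CocHopf.IsKernelHom S.1.arrow ↔
        NewmanHopf.CocModComon.IsRegularEpiOfHopf (e S).1.π) := by
  have hφ (S : NewmanHopf.HopfSubobject A) :
      ∃ Q : NewmanHopf.ModComonQuotient A, NewmanHopf.IsPhi S.arrow Q.π := by
    obtain ⟨Q, p, hp⟩ := NewmanHopf.exists_isPhi S.arrow
    have := hp.epi
    exact ⟨_, hp.mk⟩
  have hψ (Q : NewmanHopf.ModComonQuotient A) :
      ∃ S : NewmanHopf.HopfSubobject A, NewmanHopf.IsPsi Q.π S.arrow := by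
    obtain ⟨K, i, hi⟩ := NewmanHopf.exists_isPsi Q.π
    have := hi.mono
    exact ⟨_, hi.mk⟩
  choose φ hφ using hφ
  choose ψ hψ using hψ
  -- For `S` in `𝓔`, both `S` and `ψ(φ(S))` satisfy `IsPsi` for `φ(S)`, so they coincide by
  -- uniqueness; `hQ` plays the same role on `𝓠`.
  have hE {S : NewmanHopf.HopfSubobject A} (hS : NewmanHopf.IsBalancedEqualizer S.arrow) :
      NewmanHopf.IsPsi (φ S).π S.arrow := (NewmanHopf.isBalancedEqualizer_iff (hφ S)).1 hS
  have hQ {Q : NewmanHopf.ModComonQuotient A} (h : NewmanHopf.IsCotensorCoequalizer Q.π) :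
      NewmanHopf.IsPhi (ψ Q).arrow Q.π := (NewmanHopf.isCotensorCoequalizer_iff (hψ Q)).1 h
  refine ⟨
    { toFun := fun S => ⟨φ S.1, (NewmanHopf.isCotensorCoequalizer_iff (hE S.2)).2 (hφ S.1)⟩
      invFun := fun Q => ⟨ψ Q.1, (NewmanHopf.isBalancedEqualizer_iff (hQ Q.2)).2 (hψ Q.1)⟩
      left_inv := fun S => Subtype.ext (NewmanHopf.HopfSubobject.eq_of_isPsi (hψ (φ S.1)) (hE S.2))
      right_inv := fun Q =>
        Subtype.ext (NewmanHopf.ModComonQuotient.eq_of_isPhi (hφ (ψ Q.1)) (hQ Q.2)) },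
    fun S => hφ S.1, fun Q => hψ Q.1,
    fun _ => NewmanHopf.isBalancedEqualizer_of_isKernelHom,
    fun _ => NewmanHopf.isCotensorCoequalizer_of_isRegularEpiOfHopf,
    fun S => NewmanHopf.isKernelHom_iff_isRegularEpiOfHopf S.2 (hφ S.1)⟩
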